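/- Let $A=\{1,x,x'\}$ (the \emph{anchors}), with the involution $1'=1$, $(x)'=x'$, $(x')'=x$. Write a 5-tuple as $g=(g^l,g^{la},g^c,g^{ra},g^r)$, where $g^{la},g^{ra}\in A$. Put $g_{xx'}=(1,1,x,x',1)$, $G_{1,e}=\{g_{xx'}\}$, and for $i\ge 2$ $$G_{i,e}=\{(g,(g^{la})',g^l,(g^{ra})',g),\ (g,(g^{ra})',g^l,(g^{la})',g) : g\in G_{i-1,e}\}.$$ Put $G_{1,d}=G_{2,d}=\emptyset$, $G_i=G_{i,e}\cup G_{i,d}$, and for $i\ge 3$ let $G_{i,d}$ be the set of all $g\in G_{i-1}\times A\times G_{i-2}\times A\times G_{i-1}$ such that $g^l\ne g^r$; $(g^c,(g^{la})')$ is $(h^l,h^{la})$ or $(h^r,h^{ra})$ for $h=g^l$; and $(g^c,(g^{ra})')$ is $(h^l,h^{la})$ or $(h^r,h^{ra})$ for $h=g^r$. Let $G^5=\bigcup_{i\ge1}G_i$, $G=G^5\cup A$, $G'=G^5\cup\{1\}$. The height is $\upsilon(1)=0$ and $\upsilon(g)=i$ for $g\in G_i$. Let $F_1^1=G^+/\rho$,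 where $\rho$ is the congruence on the free semigroup $G^+$ generated by: $xx'x=x$, $x'xx'=x'$, $g_{xx'}=xx'$; $1h=h=h1$ for all $h\in G$; $g^2=g$ for all $g\in G'$; and, for all $g\in G^5$ with $\upsilon(g)\ge2$, $$g^c(g^{la})'g^lg^{la}g=g,\qquad g(g^{ra})'g^rg^{ra}g^c=g,\qquad g^rg^{ra}\,g\,(g^{la})'g^l=g^rg^{ra}\,g^c\,(g^{la})'g^l .$$ Write $[w]$ for the class of $w\in G^+$. A triplet $g\,a\,h$ with $g,h\in G'$, $a\in A$ is \emph{anchored} if $(g,a)\in\{(h^l,h^{la}),(h^r,h^{ra})\}$ or $(h,a')\in\{(g^l,g^{la}),(g^r,g^{ra})\}$ (the letter $1$ has no entries). A \emph{landscape} is a word $g_0a_1g_1\cdots a_ng_n$ ($n\ge0$, $g_i\in G'$, $a_i\in A$) all of whose triplets $g_{i-1}a_ig_i$ are anchored. A \emph{river} of it is a letter $g_i$, $0<i<n$, with $\upsilon(g_{i-1})=\upsilon(g_{i+1})=\upsilon(g_i)+1$. \emph{Uplifting} the river $g_i$ means the following: if $g_{i-1}=g_{i+1}$ and $a_i=a_{i+1}'$,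 replace the factor $g_{i-1}a_ig_ia_{i+1}g_{i+1}$ with $g_{i-1}$; otherwise replace the letter $g_i$ with $(g_{i+1},a_{i+1}',g_i,a_i,g_{i-1})\in G^5$. A \emph{mountain} is a landscape with first and last letter $1$ and no rivers; $M^1$ is the set of all mountains, including the one-letter word $1$. The \emph{left hill} $\lambda_l(u)$ of a mountain $u\neq1$ is its maximal prefix of the form $g_0a_1g_1\cdots a_kg_k$ with $g_{i-1}\in\{g_i^l,g_i^r\}$ for all $1\le i\le k$; the \emph{right hill} $\lambda_r(u)$ is its maximal suffix of the form $g_ka_{k+1}\cdots g_n$ with $g_i\in\{g_{i-1}^l,g_{i-1}^r\}$ for all $k<i\le n$; the \emph{peak} $\kappa(u)$ is the highest letter of $u$, i.e. the last letter of $\lambda_l(u)$. Also $\lambda_l(1)=\lambda_r(1)=\kappa(1)=1$. For mountains $u,v$, let $u*v$ be $uv$ with the double letter $11$ at the junction replaced with $1$, and let $u\odot v$ be the mountain obtained from $u*v$ by uplifting rivers until none is left. The \emph{ground} is defined by $\epsilon(1)=\{1\}$ and $\epsilon(g)=\epsilon(g^l)\cup\{g\}\cup\epsilon(g^r)$ for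 $g\in G^5$. \textbf{Statement.} The product $\odot$ is well defined: $u*v$ reduces by upliftings to exactly one mountain. The map $u\mapsto[u]$ is an isomorphism from $(M^1,\odot)$ onto $F_1^1$. For all $u,v\in M^1$, with respect to Green's relations of $(M^1,\odot)$: 1. $u\le_{\mathcal R}v$ if and only if $\lambda_l(v)$ is a prefix of $\lambda_l(u)$; 2. $u\le_{\mathcal L}v$ if and only if $\lambda_r(v)$ is a suffix of $\lambda_r(u)$; 3. $u\le_{\mathcal J}v$ if and only if $\kappa(v)\in\epsilon(\kappa(u))$; 4. $u\mathrel{\mathcal R}v$ if and only if $\lambda_l(u)=\lambda_l(v)$; $u\mathrel{\mathcal L}v$ if and only if $\lambda_r(u)=\lambda_r(v)$; $u\mathrel{\mathcal J}v$ if and only if $\kappa(u)=\kappa(v)$; $u\mathrel{\mathcal H}v$ if and only if $u=v$; and $\mathcal D=\mathcal J$. Moreover, every element of $F_1^1$ is $\mathcal D$-related to $[g]$ for exactly one $g\in G'$; that is, the classes $[g]$, $g\in G'$, are pairwise distinct and form a transversal of the $\mathcal D$-classes of $F_1^1$. -/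

import Mathlib

namespace WeakGen

section Letters

/-- The anchors `1, x, x'`. -/
inductive Anchor where
  | one : Anchor
  | x : Anchor
  | x' : Anchor
  deriving DecidableEq

/-- The involution on anchors: `1' = 1` and `x`, `x'` are swapped. -/
def Anchor.inv : Anchor → Anchor
  | .one => .one
  | .x => .x'
  | .x' => .x

/-- Raw letters: anchors and formal 5-tuples `(g^l, g^{la}, g^c, g^{ra}, g^r)`.
The letter `1` of the alphabet is `anchor .one`. -/
inductive Letter where
  | anchor (a : Anchor) : Letter
  | tup (l : Letter) (la : Anchor) (c : Letter) (ra : Anchor) (r : Letter) : Letter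
  deriving DecidableEq

namespace Letter

/-- The letter `1`. -/
def one : Letter := anchor .one

/-- The 5-tuple `g_{xx'} = (1, 1, x, x', 1)`. -/
def gxx : Letter := tup one .one (anchor .x) .x' one

/-- `Ge i` is the set `G_{i,e}` for `i ≥ 1` (and is empty for `i = 0`). -/
def Ge : ℕ → Set Letter
  | 0 => ∅
  | 1 => {gxx}
  | i + 2 => {g | ∃ l la c ra r, tup l la c ra r ∈ Ge (i + 1) ∧
      (g = tup (tup l la c ra r) la.inv l ra.inv (tup l la c ra r) ∨
        g = tup (tup l la c ra r) ra.inv l la.inv (tup l la c ra r))}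

/-- `h` is the left or the right entry of `g`, with corresponding anchor `a`: that is,
`(h, a) = (g^l, g^{la})` or `(h, a) = (g^r, g^{ra})`. Anchors (in particular `1`) have no
entries. -/
def IsSide (h : Letter) (a : Anchor) : Letter → Prop
  | anchor _ => False
  | tup l la _ ra r => (h = l ∧ a = la) ∨ (h = r ∧ a = ra)

/-- `Gd i` is the set `G_{i,d}`. -/
def Gd : ℕ → Set Letter
  | 0 => ∅
  | 1 => ∅
  | 2 => ∅
  | i + 3 => {g | ∃ l la c ra r, g = tup l la c ra r ∧
      l ∈ Ge (i + 2) ∪ Gd (i + 2) ∧ c ∈ Ge (i + 1) ∪ Gd (i + 1) ∧ r ∈ Ge (i + 2) ∪ Gd (i + 2) ∧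
      l ≠ r ∧ IsSide c la.inv l ∧ IsSide c ra.inv r}

/-- `Level i` is the set `G_i` of all 5-tuples of height `i` (for `i ≥ 1`). -/
def Level (i : ℕ) : Set Letter := Ge i ∪ Gd i

/-- The set `G^5` of 5-tuples of the alphabet. -/
def G5 : Set Letter := {g | ∃ i, g ∈ Level i}

/-- The alphabet `G = A ∪ G^5`. -/
def G : Set Letter := {g | (∃ a, g = anchor a) ∨ g ∈ G5}

/-- The set `G' = G^5 ∪ {1}`. -/
def G' : Set Letter := {g | g = one ∨ g ∈ G5}

/-- The height: `0` for `1`, and `i` for `g ∈ G_i` (see `height_of_mem_level`). -/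
def height : Letter → ℕ
  | anchor _ => 0
  | tup l _ _ _ _ => height l + 1

theorem height_of_mem_level : ∀ (i : ℕ) (g : Letter), g ∈ Level i → height g = i
  | 0, g, h => by simp [Level, Ge, Gd] at h
  | 1, g, h => by
      simp only [Level, Ge, Gd, Set.union_empty, Set.mem_singleton_iff] at h
      subst h; rfl
  | i + 2, g, h => by
      rcases h with h | h
      · simp only [Ge, Set.mem_ofPred_eq] at h
        obtain ⟨l, la, c, ra, r, hm, rfl | rfl⟩ := h
        · exact congrArg (· + 1) (height_of_mem_level (i + 1) _ (Or.inl hm))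
        · exact congrArg (· + 1) (height_of_mem_level (i + 1) _ (Or.inl hm))
      · cases i with
        | zero => simp [Gd] at h
        | succ i =>
          simp only [Gd, Set.mem_ofPred_eq] at h
          obtain ⟨l, la, c, ra, r, rfl, hl, -⟩ := h
          exact congrArg (· + 1) (height_of_mem_level (i + 2) l hl)

theorem height_of_isSide {g h : Letter} {a : Anchor} (hg : g ∈ G') (hs : IsSide h a g) :
    height g = height h + 1 := by
  cases g with
  | anchor b => exact hs.elim
  | tup l la c ra r =>
    rcases hs with ⟨rfl, -⟩ | ⟨rfl, -⟩
    · rfl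
    · rcases hg with hg | ⟨i, hi⟩
      · cases hg
      · rcases i with _ | _ | i
        · simp [Level, Ge, Gd] at hi
        · simp only [Level, Ge, Gd, Set.union_empty, Set.mem_singleton_iff, gxx] at hi
          cases hi; rfl
        · rcases hi with hi | hi
          · simp only [Ge, Set.mem_ofPred_eq] at hi
            obtain ⟨_, _, _, _, _, -, hi | hi⟩ := hi <;> cases hi <;> rfl
          · cases i with
            | zero => simp [Gd] at hi
            | succ i =>
              simp only [Gd, Set.mem_ofPred_eq] at hi
              obtain ⟨_, _, _, _, _, he, hl, -, hr, -⟩ := hi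
              cases he
              exact congrArg (· + 1) ((height_of_mem_level (i + 2) _ hl).trans
                (height_of_mem_level (i + 2) _ hr).symm)

/-- The ground of a letter of `G'`. -/
def ground : Letter → Set Letter
  | anchor a => {anchor a}
  | tup l la c ra r => ground l ∪ {tup l la c ra r} ∪ ground r

end Letter

end Letters

section Presentation

/-- The alphabet `G` as a type. -/
abbrev Alphabet : Type := {g : Letter // g ∈ Letter.G}

/-- The set `G'` as a type. -/
abbrev GPrime : Type := {g : Letter // g ∈ Letter.G'}

/-- An anchor as a letter of the alphabet. -/
def Anchor.toAlphabet (a : Anchor) : Alphabet := ⟨.anchor a, Or.inl ⟨a, rfl⟩⟩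

/-- The inclusion of `G'` into `G`. -/
def GPrime.toAlphabet (g : GPrime) : Alphabet :=
  ⟨g.1, g.2.elim (fun h => Or.inl ⟨.one, h⟩) Or.inr⟩

/-- The letter `1` as an element of `G'`. -/
def GPrime.one : GPrime := ⟨Letter.one, Or.inl rfl⟩

/-- The free semigroup `G⁺`. -/
abbrev Word : Type := FreeSemigroup Alphabet

/-- A letter as a word of length one. -/
abbrev letter (g : Alphabet) : Word := FreeSemigroup.of g

/-- An anchor as a word of length one. -/
abbrev anc (a : Anchor) : Word := FreeSemigroup.of a.toAlphabet

/-- The defining relations. The relations `left`, `right`, `middle` are those of `ρ_s`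
for `g = (l, la, c, ra, r)` of height at least two:
`g^c (g^{la})' g^l g^{la} g = g`, `g (g^{ra})' g^r g^{ra} g^c = g` and
`g^r g^{ra} g (g^{la})' g^l = g^r g^{ra} g^c (g^{la})' g^l`. -/
inductive Rel : Word → Word → Prop
  | xx'x : Rel (anc .x * anc .x' * anc .x) (anc .x)
  | x'xx' : Rel (anc .x' * anc .x * anc .x') (anc .x')
  | gxx (g : Alphabet) (hg : g.1 = Letter.gxx) : Rel (letter g) (anc .x * anc .x')
  | one_mul (g : Alphabet) : Rel (anc .one * letter g) (letter g)
  | mul_one (g : Alphabet) : Rel (letter g * anc .one) (letter g)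
  | idem (g : GPrime) : Rel (letter g.toAlphabet * letter g.toAlphabet) (letter g.toAlphabet)
  | left (g l c r : Alphabet) (la ra : Anchor) (hg : g.1 = .tup l.1 la c.1 ra r.1)
      (h2 : 2 ≤ g.1.height) :
      Rel (letter c * anc la.inv * letter l * anc la * letter g) (letter g)
  | right (g l c r : Alphabet) (la ra : Anchor) (hg : g.1 = .tup l.1 la c.1 ra r.1)
      (h2 : 2 ≤ g.1.height) :
      Rel (letter g * anc ra.inv * letter r * anc ra * letter c) (letter g)
  | middle (g l c r : Alphabet) (la ra : Anchor) (hg : g.1 = .tup l.1 la c.1 ra r.1)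
      (h2 : 2 ≤ g.1.height) :
      Rel (letter r * anc ra * letter g * anc la.inv * letter l)
        (letter r * anc ra * letter c * anc la.inv * letter l)

/-- The monoid `F_1^1 = G⁺/ρ`, where `ρ` is the congruence generated by the relations. -/
abbrev F11 : Type := (conGen Rel).Quotient

/-- The class `[w]` of a word. -/
def cls (w : Word) : F11 := (w : (conGen Rel).Quotient)

end Presentation

section Landscapes

/-- Alternating words `g₀ a₁ g₁ ⋯ aₙ gₙ` with `gᵢ ∈ G'` and `aᵢ` anchors: `head` is `g₀` and
`steps` is the list of the pairs `(aᵢ, gᵢ)`. -/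
@[ext]
structure AltWord where
  head : GPrime
  steps : List (Anchor × GPrime)

/-- The last letter of the alternating word with first letter `g` and steps `s`. -/
def endOf : GPrime → List (Anchor × GPrime) → GPrime
  | g, [] => g
  | _, (_, h) :: s => endOf h s

/-- Every triplet `gᵢ₋₁ aᵢ gᵢ` of the alternating word satisfies `P`. -/
def Along (P : GPrime → Anchor → GPrime → Prop) : GPrime → List (Anchor × GPrime) → Prop
  | _, [] => True
  | g, (a, h) :: s => P g a h ∧ Along P h s

/-- The triplet `g a h` is anchored: either it is left anchored, that is `(g, a)` is
`(h^l, h^{la})` or `(h^r, h^{ra})`, or it is right anchored, that is `(h, a)` is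
`(g^l, (g^{la})')` or `(g^r, (g^{ra})')`. -/
def Anchored (g : GPrime) (a : Anchor) (h : GPrime) : Prop :=
  Letter.IsSide g.1 a h.1 ∨ Letter.IsSide h.1 a.inv g.1

/-- `g` is the left or the right entry of `h`. -/
def IsEntry (g h : GPrime) : Prop := ∃ a, Letter.IsSide g.1 a h.1

namespace AltWord

/-- The letters of the word that follow the first one. -/
def tailLetters (s : List (Anchor × GPrime)) : List Alphabet :=
  s.flatMap fun p => [p.1.toAlphabet, p.2.toAlphabet]

/-- The list of all letters `g₀, a₁, g₁, …, aₙ, gₙ`. -/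
def letters (w : AltWord) : List Alphabet := w.head.toAlphabet :: tailLetters w.steps

/-- The underlying word of `G⁺`. -/
def toWord (w : AltWord) : Word := ⟨w.head.toAlphabet, tailLetters w.steps⟩

/-- The last letter. -/
def last (w : AltWord) : GPrime := endOf w.head w.steps

/-- Landscapes. -/
def IsLandscape (w : AltWord) : Prop := Along Anchored w.head w.steps

/-- `w = ⋯ g₀ a g b h ⋯`, where the part up to `g₀` has steps `p` and `s` are the steps after
`h`, and the displayed letter `g` is a river: `g₀` and `h` have height one more than `g`. -/
def RiverAt (w : AltWord) (p : List (Anchor × GPrime)) (a : Anchor) (g : GPrime) (b : Anchor)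
    (h : GPrime) (s : List (Anchor × GPrime)) : Prop :=
  w.steps = p ++ (a, g) :: (b, h) :: s ∧
    (endOf w.head p).1.height = g.1.height + 1 ∧ h.1.height = g.1.height + 1

/-- `w` has no rivers. -/
def NoRiver (w : AltWord) : Prop := ∀ p a g b h s, ¬ w.RiverAt p a g b h s

/-- `u * v` (for `u` ending with the first letter of `v`): the concatenation in which the double
letter at the junction is written only once. -/
def star (u v : AltWord) : AltWord := ⟨u.head, u.steps ++ v.steps⟩

/-- `v` is obtained from the landscape `u` by uplifting one river: in `⋯ g₀ a g b h ⋯` with river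
`g`, the factor `g₀ a g b h` is replaced with `g₀` if `g₀ = h` and `a = b'`, and otherwise `g` is
replaced with the 5-tuple `k = (h, b', g, a, g₀)`. -/
def Uplift (u v : AltWord) : Prop :=
  u.IsLandscape ∧ ∃ p a g b h s, u.RiverAt p a g b h s ∧
    ((endOf u.head p = h ∧ a = b.inv ∧ v = ⟨u.head, p ++ s⟩) ∨
      (¬ (endOf u.head p = h ∧ a = b.inv) ∧ ∃ k : GPrime,
        k.1 = .tup h.1 b.inv g.1 a (endOf u.head p).1 ∧
          v = ⟨u.head, p ++ (a, k) :: (b, h) :: s⟩))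

open Classical in
/-- The steps of the longest prefix all of whose steps go up. -/
noncomputable def upSteps : GPrime → List (Anchor × GPrime) → List (Anchor × GPrime)
  | _, [] => []
  | g, (a, h) :: s => if IsEntry g h then (a, h) :: upSteps h s else []

open Classical in
/-- The longest suffix all of whose steps go down. -/
noncomputable def downSuffix : GPrime → List (Anchor × GPrime) → AltWord
  | g, [] => ⟨g, []⟩
  | g, (a, h) :: s =>
      if Along (fun g₁ _ g₂ => IsEntry g₂ g₁) g ((a, h) :: s) then ⟨g, (a, h) :: s⟩
      else downSuffix h s

/-- In a landscape without rivers, no letter is higher than the end of the initial climb. -/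
theorem height_le_of_noRiver : ∀ (s : List (Anchor × GPrime)) (g : GPrime),
    (AltWord.mk g s).IsLandscape → (AltWord.mk g s).NoRiver →
      (g.1.height ≤ (endOf g (upSteps g s)).1.height) ∧
      ∀ q ∈ s, q.2.1.height ≤ (endOf g (upSteps g s)).1.height
  | [], g, _, _ => by simp [upSteps, endOf]
  | (a, h) :: s, g, hl, hn => by
      have hl' : (AltWord.mk h s).IsLandscape := hl.2
      have hn' : (AltWord.mk h s).NoRiver := fun p a₁ g₁ b₁ h₁ s₁ hr =>
        hn ((a, h) :: p) a₁ g₁ b₁ h₁ s₁ ⟨by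
          have := hr.1
          simp only at this
          simp [this], hr.2⟩
      have ih := height_le_of_noRiver s h hl' hn'
      by_cases he : IsEntry g h
      · simp only [upSteps, he, if_true, endOf, List.mem_cons]
        obtain ⟨b, hb⟩ := he
        have hh := Letter.height_of_isSide h.2 hb
        refine ⟨by omega, ?_⟩
        rintro q (rfl | hq)
        · exact ih.1
        · exact ih.2 q hq
      · have hd : g.1.height = h.1.height + 1 := by
          rcases hl.1 with h1 | h1
          · exact (he ⟨a, h1⟩).elim
          · exact Letter.height_of_isSide g.2 h1
        have hu : upSteps h s = [] := by
          cases s with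
          | nil => rfl
          | cons q s =>
            obtain ⟨b, k⟩ := q
            by_cases hk : IsEntry h k
            · obtain ⟨b', hb'⟩ := hk
              exact (hn [] a h b k s ⟨rfl, hd, Letter.height_of_isSide k.2 hb'⟩).elim
            · simp [upSteps, hk]
        rw [hu] at ih
        simp only [endOf] at ih
        simp only [upSteps, he, if_false, endOf, List.mem_cons]
        refine ⟨le_rfl, ?_⟩
        rintro q (rfl | hq)
        · simp only; omega
        · have := ih.2 q hq
          omega

end AltWord

/-- The set `M^1` of mountains: landscapes from `1` to `1` with no rivers (the trivial mountain
`1` included). -/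
@[ext]
structure Mountain where
  word : AltWord
  landscape : word.IsLandscape
  head_eq : word.head = GPrime.one
  last_eq : word.last = GPrime.one
  noRiver : word.NoRiver

namespace Mountain

/-- The trivial mountain. -/
def trivial : Mountain where
  word := ⟨GPrime.one, []⟩
  landscape := True.intro
  head_eq := rfl
  last_eq := rfl
  noRiver := by
    intro p a g b h s hr
    have h1 := hr.1
    simp at h1

instance : Nonempty Mountain := ⟨trivial⟩

/-- The left hill: the maximal prefix that is an uphill (the word `1` for the trivial mountain). -/
noncomputable def leftHill (u : Mountain) : AltWord :=
  ⟨u.word.head, AltWord.upSteps u.word.head u.word.steps⟩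

/-- The right hill: the maximal suffix that is a downhill (the word `1` for the trivial
mountain). -/
noncomputable def rightHill (u : Mountain) : AltWord :=
  AltWord.downSuffix u.word.head u.word.steps

/-- The peak: the last letter of the left hill, which is the only ridge and the highest letter of a
nontrivial mountain (see `height_le_peak`), and `1` for the trivial mountain. -/
noncomputable def peak (u : Mountain) : GPrime := u.leftHill.last

theorem height_le_peak (u : Mountain) :
    ∀ q ∈ u.word.steps, q.2.1.height ≤ u.peak.1.height :=
  (AltWord.height_le_of_noRiver u.word.steps u.word.head u.landscape u.noRiver).2

/-- `u ⊙ v` is the mountain obtained from `u * v` by uplifting rivers until none is left. -/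
noncomputable instance : Mul Mountain where
  mul u v := Classical.epsilon fun w : Mountain =>
    Relation.ReflTransGen AltWord.Uplift (u.word.star v.word) w.word

end Mountain

end Landscapes

section Green

variable {S : Type*} [Mul S]

/-- `s ≤_R t`, that is `s S¹ ⊆ t S¹`. -/
def LeR (s t : S) : Prop :=
  {y : S | ∃ p : WithOne S, (y : WithOne S) = s * p} ⊆
    {y : S | ∃ p : WithOne S, (y : WithOne S) = t * p}

/-- `s ≤_L t`, that is `S¹ s ⊆ S¹ t`. -/
def LeL (s t : S) : Prop :=
  {y : S | ∃ p : WithOne S, (y : WithOne S) = p * s} ⊆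
    {y : S | ∃ p : WithOne S, (y : WithOne S) = p * t}

/-- `s ≤_J t`, that is `S¹ s S¹ ⊆ S¹ t S¹`. -/
def LeJ (s t : S) : Prop :=
  {y : S | ∃ p q : WithOne S, (y : WithOne S) = p * s * q} ⊆
    {y : S | ∃ p q : WithOne S, (y : WithOne S) = p * t * q}

/-- Green's relation `R`. -/
def GreenR (s t : S) : Prop := LeR s t ∧ LeR t s

/-- Green's relation `L`. -/
def GreenL (s t : S) : Prop := LeL s t ∧ LeL t s

/-- Green's relation `J`. -/
def GreenJ (s t : S) : Prop := LeJ s t ∧ LeJ t s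

/-- Green's relation `H`, the intersection of `L` and `R`. -/
def GreenH (s t : S) : Prop := GreenL s t ∧ GreenR s t

/-- Green's relation `D`, the join of `L` and `R` in the lattice of equivalence relations. -/
def GreenD (s t : S) : Prop := Relation.EqvGen (fun a b => GreenL a b ∨ GreenR a b) s t

end Green

end WeakGen

/-! Uplifting is a terminating rewriting system with the diamond property, so each landscape has
exactly one normal form. Two rivers are never consecutive letters of `G'` in a landscape, hence the
replaced factors coincide or share at most an endpoint (`up_diamond`). Each uplifting lowers a
measure of the room left below a height bound (`Up.depth_lt`). Mountains are therefore
representatives of the classes of `Conv`, the convertibility of landscapes from `1` to `1`, and `⊙`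
is concatenation modulo `Conv`.

The isomorphism with `F11` rests on two translations. Evaluating a landscape in `F11` is invariant
under uplifting (`ev_eq_of_conv`): raising a river is the relation `middle`, and removing one is a
consequence of `left`, `right` and idempotency (`IsTup.val_cancel`). Conversely, each letter of `G`
is expanded into a landscape from `1` to `1`, a letter of `G'` into a canonical hill up and down,
and the defining relations then hold up to `Conv` (`conv_of_rel`). The translations are mutually
inverse by `ev_wordPath` and `Mountain.conv_toWord`; the latter depends on `conv_side`, which
contracts the expansion of an anchored triplet to a single step.

For Green's relations, a mountain is an uphill followed by a downhill. The factor of an uplifting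
starts with a step down and ends with a step up, so an uphill prefix and a downhill suffix survive
every uplifting, and the letters visited stay in the grounds of letters still visited. This bounds
the hills and peaks of products. Multipliers come from walking a hill backwards, since a hill and
its reverse cancel. Mountains with equal peaks can exchange hills, which gives `D = J`; the classes
of `D` are then indexed by the peaks, and `[g]` is the class of the canonical mountain with peak
`g`. -/

namespace WeakGen

/-! ### Structure of the letters: which 5-tuples belong to the alphabet. -/

section LetterStructure

theorem Anchor.inv_inv (a : Anchor) : a.inv.inv = a := by cases a <;> rfl

theorem Anchor.inv_injective : Function.Injective Anchor.inv := fun a b h => by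
  rw [← a.inv_inv, h, b.inv_inv]

namespace Letter

theorem mem_G'_of_mem_level {i : ℕ} {g : Letter} (h : g ∈ Level i) : g ∈ G' := Or.inr ⟨i, h⟩

/-- Inversion of anchors is injective, so the distinct anchors of `g_{xx'}` remain distinct along
the recursion. Equal sides with distinct anchors separate these letters from those of `Gd`, whose
sides differ. -/
theorem exists_tup_of_mem_Ge : ∀ (i : ℕ) {g : Letter}, g ∈ Ge i →
    ∃ l la c ra, g = tup l la c ra l ∧ la ≠ ra ∧ l ∈ G'
  | 0, _, h => h.elim
  | 1, _, h => ⟨one, .one, anchor .x, .x', h, by decide, Or.inl rfl⟩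
  | i + 2, _, h => by
    obtain ⟨l, la, c, ra, r, hm, h⟩ := h
    obtain ⟨_, _, _, _, he, hne, -⟩ := exists_tup_of_mem_Ge (i + 1) hm
    cases he
    rcases h with rfl | rfl
    · exact ⟨_, _, _, _, rfl, fun h => hne (Anchor.inv_injective h),
        mem_G'_of_mem_level (Or.inl hm)⟩
    · exact ⟨_, _, _, _, rfl, fun h => hne (Anchor.inv_injective h).symm,
        mem_G'_of_mem_level (Or.inl hm)⟩

/-- Letters of `G'` other than `1` and `g_{xx'}` are the 5-tuples over `G'` whose sides are
distinct and cover the central letter. -/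
theorem cases_of_mem_G' {g : Letter} (hg : g ∈ G') : g = one ∨ g = gxx ∨
    ∃ l la c ra r, g = tup l la c ra r ∧ l ∈ G' ∧ c ∈ G' ∧ r ∈ G' ∧
      IsSide c la.inv l ∧ IsSide c ra.inv r ∧ ¬(l = r ∧ la = ra) := by
  rcases hg with hg | ⟨i, hg⟩
  · exact Or.inl hg
  right
  rcases i with _ | _ | i
  · simp [Level, Ge, Gd] at hg
  · left
    simpa [Level, Ge, Gd] using hg
  right
  rcases hg with hg | hg
  · obtain ⟨l, la, c, ra, r, hm, hg⟩ := hg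
    obtain ⟨_, _, _, _, he, hne, hl⟩ := exists_tup_of_mem_Ge (i + 1) hm
    cases he
    have hh := mem_G'_of_mem_level (Or.inl hm : _ ∈ Level (i + 1))
    rcases hg with rfl | rfl
    · exact ⟨_, _, _, _, _, rfl, hh, hl, hh, by simp [IsSide, Anchor.inv_inv],
        by simp [IsSide, Anchor.inv_inv], fun h => hne (Anchor.inv_injective h.2)⟩
    · exact ⟨_, _, _, _, _, rfl, hh, hl, hh, by simp [IsSide, Anchor.inv_inv],
        by simp [IsSide, Anchor.inv_inv], fun h => hne (Anchor.inv_injective h.2).symm⟩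
  · cases i with
    | zero => simp [Gd] at hg
    | succ i =>
      obtain ⟨l, la, c, ra, r, rfl, hl, hc, hr, hne, h1, h2⟩ := hg
      exact ⟨_, _, _, _, _, rfl, mem_G'_of_mem_level hl, mem_G'_of_mem_level hc,
        mem_G'_of_mem_level hr, h1, h2, fun h => hne h.1⟩

theorem mem_level_height {g : Letter} (hg : g ∈ G') (h : g ≠ one) : g ∈ Level g.height := by
  rcases hg with hg | ⟨i, hg⟩
  · exact (h hg).elim
  · rwa [height_of_mem_level i g hg]

theorem eq_gxx_of_height {g : Letter} (hg : g ∈ G') (h : g.height = 1) : g = gxx := by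
  have := mem_level_height hg (by rintro rfl; simp [height, one] at h)
  rw [h] at this
  simpa [Level, Ge, Gd] using this

/-- Uplifting never leaves the alphabet because of this closure property. Both sides are one higher
than `c`; equal sides lead to the recursion for `Ge`, different ones to `Gd`. -/
theorem tup_mem_G' {l c r : Letter} {la ra : Anchor} (hl : l ∈ G') (hc : c ∈ G') (hr : r ∈ G')
    (h1 : IsSide c la.inv l) (h2 : IsSide c ra.inv r) (hne : ¬(l = r ∧ la = ra)) :
    tup l la c ra r ∈ G' := by
  have e1 := height_of_isSide hl h1
  have e2 := height_of_isSide hr h2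
  have hl' : l ∈ Level (height c + 1) := e1 ▸ mem_level_height hl (by rintro rfl; exact h1)
  have hr' : r ∈ Level (height c + 1) := e2 ▸ mem_level_height hr (by rintro rfl; exact h2)
  by_cases hlr : l = r
  · subst hlr
    have hla : la ≠ ra := fun h => hne ⟨rfl, h⟩
    -- A letter of `Gd` has different sides, so `c` would occur in `l` with only one anchor, against
    -- `la ≠ ra`.
    have key : l ∈ Ge (height c + 1) := by
      rcases hl' with h | h
      · exact h
      · exfalso
        rcases hj : height c + 1 with _ | _ | _ | j
        · omega
        · simp [hj, Gd] at h
        · simp [hj, Gd] at h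
        · rw [hj] at h
          obtain ⟨l', la', c', ra', r', rfl, -, -, -, hn, -⟩ := h
          rcases h1 with ⟨rfl, h1⟩ | ⟨rfl, h1⟩ <;> rcases h2 with ⟨h3, h2⟩ | ⟨h3, h2⟩
          · exact hla (Anchor.inv_injective (h1.trans h2.symm))
          · exact hn h3
          · exact hn h3.symm
          · exact hla (Anchor.inv_injective (h1.trans h2.symm))
    refine mem_G'_of_mem_level (i := height c + 2) (Or.inl ?_)
    obtain ⟨l', la', c', ra', rfl, -, -⟩ := exists_tup_of_mem_Ge _ key
    refine ⟨_, _, _, _, _, key, ?_⟩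
    rcases h1 with ⟨rfl, h1⟩ | ⟨rfl, h1⟩ <;> rcases h2 with ⟨h3, h2⟩ | ⟨h3, h2⟩
    · exact (hla (Anchor.inv_injective (h1.trans h2.symm))).elim
    · left; rw [← h1, ← h2, Anchor.inv_inv, Anchor.inv_inv]
    · right; rw [← h1, ← h2, Anchor.inv_inv, Anchor.inv_inv]
    · exact (hla (Anchor.inv_injective (h1.trans h2.symm))).elim
  · have hc1 : c ≠ one := by
      rintro rfl
      exact hlr ((eq_gxx_of_height hl e1).trans (eq_gxx_of_height hr e2).symm)
    have hc' := mem_level_height hc hc1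
    rcases hj : height c with _ | j
    · rw [hj] at hc'; simp [Level, Ge, Gd] at hc'
    · rw [hj] at hc' hl' hr'
      exact mem_G'_of_mem_level (i := j + 3)
        (Or.inr ⟨_, _, _, _, _, rfl, hl', hc', hr', hlr, h1, h2⟩)

end Letter

/-- `g` is a side of `h` with anchor `a`, for letters of `G'`. -/
abbrev Side (g : GPrime) (a : Anchor) (h : GPrime) : Prop := Letter.IsSide g.1 a h.1

/-- The height of a letter of `G'`. -/
abbrev GPrime.height (g : GPrime) : ℕ := g.1.height

theorem Side.height {g h : GPrime} {a : Anchor} (hs : Side g a h) : h.height = g.height + 1 :=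
  Letter.height_of_isSide h.2 hs

/-- The letter `g_{xx'}`. -/
def GPrime.gxx : GPrime := ⟨Letter.gxx, Letter.mem_G'_of_mem_level (i := 1) (Or.inl rfl)⟩

/-- `g = (l, la, c, ra, r)` with all three letters in `G'`, so that `g` has height at least two. -/
structure IsTup (g l : GPrime) (la : Anchor) (c : GPrime) (ra : Anchor) (r : GPrime) : Prop where
  eq : g.1 = .tup l.1 la c.1 ra r.1
  left : Side c la.inv l
  right : Side c ra.inv r
  ne : ¬(l = r ∧ la = ra)

theorem GPrime.cases (g : GPrime) : g = GPrime.one ∨ g = GPrime.gxx ∨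
    ∃ l la c ra r, IsTup g l la c ra r := by
  rcases Letter.cases_of_mem_G' g.2 with h | h | ⟨l, la, c, ra, r, h, hl, hc, hr, h1, h2, h3⟩
  · exact Or.inl (Subtype.ext h)
  · exact Or.inr (Or.inl (Subtype.ext h))
  · exact Or.inr (Or.inr ⟨⟨l, hl⟩, la, ⟨c, hc⟩, ra, ⟨r, hr⟩, h, h1, h2,
      fun h => h3 ⟨congrArg Subtype.val h.1, h.2⟩⟩)

theorem exists_isTup {l c r : GPrime} {la ra : Anchor} (h1 : Side c la.inv l)
    (h2 : Side c ra.inv r) (hne : ¬(l = r ∧ la = ra)) : ∃ g, IsTup g l la c ra r :=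
  ⟨⟨_, Letter.tup_mem_G' l.2 c.2 r.2 h1 h2 fun h => hne ⟨Subtype.ext h.1, h.2⟩⟩, rfl, h1, h2, hne⟩

namespace IsTup

variable {g l c r : GPrime} {la ra : Anchor}

theorem sideLeft (h : IsTup g l la c ra r) : Side l la g := by
  rw [Side, h.eq]; exact Or.inl ⟨rfl, rfl⟩

theorem sideRight (h : IsTup g l la c ra r) : Side r ra g := by
  rw [Side, h.eq]; exact Or.inr ⟨rfl, rfl⟩

theorem side_iff (h : IsTup g l la c ra r) {m : GPrime} {a : Anchor} :
    Side m a g ↔ (m = l ∧ a = la) ∨ (m = r ∧ a = ra) := by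
  rw [Side, h.eq, Subtype.ext_iff, Subtype.ext_iff]; rfl

theorem height_eq (h : IsTup g l la c ra r) : g.height = c.height + 2 := by
  rw [h.sideLeft.height, h.left.height]

end IsTup

theorem side_gxx_iff {m : GPrime} {a : Anchor} :
    Side m a GPrime.gxx ↔ m = GPrime.one ∧ (a = .one ∨ a = .x') := by
  rw [Subtype.ext_iff]
  constructor
  · rintro (⟨h, h'⟩ | ⟨h, h'⟩)
    · exact ⟨h, Or.inl h'⟩
    · exact ⟨h, Or.inr h'⟩
  · rintro ⟨h, h' | h'⟩
    · exact Or.inl ⟨h, h'⟩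
    · exact Or.inr ⟨h, h'⟩

theorem Anchored.height {g h : GPrime} {a : Anchor} (hs : Anchored g a h) :
    h.height = g.height + 1 ∧ Side g a h ∨ g.height = h.height + 1 ∧ Side h a.inv g := by
  rcases hs with hs | hs
  · exact Or.inl ⟨Side.height hs, hs⟩
  · exact Or.inr ⟨Side.height hs, hs⟩

theorem Anchored.side {g h : GPrime} {a : Anchor} (hs : Anchored g a h)
    (hh : h.height = g.height + 1) : Side g a h := by
  rcases hs.height with h1 | h1
  · exact h1.2
  · omega

theorem Anchored.side' {g h : GPrime} {a : Anchor} (hs : Anchored g a h)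
    (hh : g.height = h.height + 1) : Side h a.inv g := by
  rcases hs.height with h1 | h1
  · omega
  · exact h1.2

end LetterStructure

/-! ### Uplifting as a rewriting system: confluence and termination. -/

section Rewriting

theorem endOf_append : ∀ (s : List (Anchor × GPrime)) (g : GPrime) (t : List (Anchor × GPrime)),
    endOf g (s ++ t) = endOf (endOf g s) t
  | [], _, _ => rfl
  | (_, h) :: s, _, t => endOf_append s h t

theorem along_append {P : GPrime → Anchor → GPrime → Prop} :
    ∀ (s : List (Anchor × GPrime)) (g : GPrime) (t : List (Anchor × GPrime)),
    Along P g (s ++ t) ↔ Along P g s ∧ Along P (endOf g s) t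
  | [], _, _ => by simp [Along, endOf]
  | (a, h) :: s, g, t => by
    simp only [List.cons_append, Along, endOf, along_append s h t, and_assoc]

/-- The local rule of uplifting: the steps `s` through a river that start at `g` are replaced
with `t`. -/
def Rule (g : GPrime) (s t : List (Anchor × GPrime)) : Prop :=
  ∃ a m b h, s = [(a, m), (b, h)] ∧ Side m a.inv g ∧ Side m b h ∧
    ((g = h ∧ a = b.inv ∧ t = []) ∨
      ¬(g = h ∧ a = b.inv) ∧ ∃ k, IsTup k h b.inv m a g ∧ t = [(a, k), (b, h)])

/-- Uplifting a river, as a relation between the steps of landscapes with first letter `g`. -/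
def Up (g : GPrime) (s t : List (Anchor × GPrime)) : Prop := AltWord.Uplift ⟨g, s⟩ ⟨g, t⟩

theorem up_iff {g : GPrime} {s t : List (Anchor × GPrime)} : Up g s t ↔
    Along Anchored g s ∧ ∃ p q q' r, s = p ++ (q ++ r) ∧ t = p ++ (q' ++ r) ∧
      Rule (endOf g p) q q' := by
  constructor
  · rintro ⟨hl, p, a, m, b, h, r, ⟨h1, h2, h3⟩, h4⟩
    refine ⟨hl, p, [(a, m), (b, h)], ?_⟩
    simp only at h1 h2 h3 h4
    subst h1
    have hl' := ((along_append _ _ _).1 hl).2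
    have s1 := hl'.1.side' h2
    have s2 := hl'.2.1.side h3
    rcases h4 with ⟨h4, h5, h6⟩ | ⟨h4, k, h5, h6⟩
    · exact ⟨[], r, rfl, (AltWord.mk.inj h6).2, a, m, b, h, rfl, s1, s2, Or.inl ⟨h4, h5, rfl⟩⟩
    · refine ⟨[(a, k), (b, h)], r, rfl, (AltWord.mk.inj h6).2, a, m, b, h, rfl, s1, s2,
        Or.inr ⟨h4, k, ⟨h5, by rwa [Anchor.inv_inv], s1, ?_⟩, rfl⟩⟩
      exact fun h => h4 ⟨h.1.symm, h.2.symm⟩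
  · rintro ⟨hl, p, _, q', r, rfl, rfl, a, m, b, h, rfl, s1, s2, h4⟩
    refine ⟨hl, p, a, m, b, h, r, ⟨rfl, s1.height, s2.height⟩, ?_⟩
    rcases h4 with ⟨h4, h5, rfl⟩ | ⟨h4, k, h5, rfl⟩
    · exact Or.inl ⟨h4, h5, rfl⟩
    · exact Or.inr ⟨h4, k, h5.eq, rfl⟩

theorem Rule.endOf_eq {g : GPrime} {s t : List (Anchor × GPrime)} (h : Rule g s t) :
    endOf g t = endOf g s := by
  obtain ⟨a, m, b, h, rfl, -, -, ⟨rfl, -, rfl⟩ | ⟨-, k, -, rfl⟩⟩ := h <;> rfl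

theorem Rule.along {g : GPrime} {s t : List (Anchor × GPrime)} (h : Rule g s t) :
    Along Anchored g t := by
  obtain ⟨a, m, b, h, rfl, -, -, ⟨rfl, -, rfl⟩ | ⟨-, k, hk, rfl⟩⟩ := h
  · trivial
  · exact ⟨Or.inl hk.sideRight, Or.inr hk.sideLeft, trivial⟩

theorem Rule.unique {g : GPrime} {s t t' : List (Anchor × GPrime)} (h : Rule g s t)
    (h' : Rule g s t') : t = t' := by
  obtain ⟨a, m, b, h, rfl, -, -, h1⟩ := h
  obtain ⟨_, _, _, _, he, -, -, h2⟩ := h'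
  cases he
  rcases h1 with ⟨e1, e2, rfl⟩ | ⟨h1, k, hk, rfl⟩ <;>
    rcases h2 with ⟨e3, e4, rfl⟩ | ⟨h2, k', hk', rfl⟩
  · rfl
  · exact (h2 ⟨e1, e2⟩).elim
  · exact (h1 ⟨e3, e4⟩).elim
  · rw [show k = k' from Subtype.ext (hk.eq.trans hk'.eq.symm)]

/-- `s` are the steps of a landscape from `g` to `h`. -/
def Path (g : GPrime) (s : List (Anchor × GPrime)) (h : GPrime) : Prop :=
  Along Anchored g s ∧ endOf g s = h

theorem Path.append {g h k : GPrime} {s t : List (Anchor × GPrime)} (h1 : Path g s h)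
    (h2 : Path h t k) : Path g (s ++ t) k := by
  obtain ⟨h1, rfl⟩ := h1
  exact ⟨(along_append _ _ _).2 ⟨h1, h2.1⟩, (endOf_append _ _ _).trans h2.2⟩

theorem Path.nil (g : GPrime) : Path g [] g := ⟨trivial, rfl⟩

theorem Path.cons {g m h : GPrime} {a : Anchor} {s : List (Anchor × GPrime)}
    (h1 : Anchored g a m) (h2 : Path m s h) : Path g ((a, m) :: s) h := ⟨⟨h1, h2.1⟩, h2.2⟩

theorem Path.single {g h : GPrime} {a : Anchor} (h1 : Anchored g a h) : Path g [(a, h)] h :=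
  ⟨⟨h1, trivial⟩, rfl⟩

theorem Up.path_iff {g h : GPrime} {s t : List (Anchor × GPrime)} (hu : Up g s t) :
    Path g s h ↔ Path g t h := by
  obtain ⟨hl, p, q, q', r, rfl, rfl, hr⟩ := up_iff.1 hu
  simp only [Path, along_append, endOf_append, hr.endOf_eq, hr.along, true_and] at hl ⊢
  tauto

theorem Up.append_left {g h : GPrime} {s t p : List (Anchor × GPrime)} (hu : Up h s t)
    (hp : Path g p h) : Up g (p ++ s) (p ++ t) := by
  obtain ⟨hp, rfl⟩ := hp
  obtain ⟨hl, p', q, q', r, rfl, rfl, hr⟩ := up_iff.1 hu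
  refine up_iff.2 ⟨(along_append _ _ _).2 ⟨hp, hl⟩, p ++ p', q, q', r, by simp, by simp, ?_⟩
  rwa [endOf_append]

theorem Up.append_right {g h k : GPrime} {s t p : List (Anchor × GPrime)} (hu : Up g s t)
    (hs : Path g s h) (hp : Path h p k) : Up g (s ++ p) (t ++ p) := by
  obtain ⟨hl, p', q, q', r, rfl, rfl, hr⟩ := up_iff.1 hu
  exact up_iff.2 ⟨(hs.append hp).1, p', q, q', r ++ p, by simp, by simp, hr⟩

/-- The first factor makes the step `w` go up from its river; the second would make the same step go
down. -/
theorem Rule.not_overlap {g : GPrime} {z w : Anchor × GPrime} {q q' t : List (Anchor × GPrime)}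
    (h : Rule g [z, w] q) : ¬ Rule z.2 (w :: t) q' := by
  rintro ⟨_, _, _, _, he, s1, -, -⟩
  obtain ⟨_, _, _, _, he', s1', s2', -⟩ := h
  cases he; cases he'
  have := Side.height s1; have := Side.height s1'; have := Side.height s2'
  simp only at *
  omega

/-- The list `c` is the gap between the starts of the two factors. With no gap the factors agree and
the result is unique; a gap of one step is excluded by `Rule.not_overlap`; with a longer gap the
factors are disjoint and the replacements commute. -/
theorem up_diamond_aux {g : GPrime} {p q q' r c d d' e : List (Anchor × GPrime)}
    (hl : Along Anchored g (p ++ (q ++ r))) (h1 : Rule (endOf g p) q q')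
    (h2 : Rule (endOf g (p ++ c)) d d') (he : q ++ r = c ++ (d ++ e)) :
    ∃ t, Relation.ReflGen (Up g) (p ++ (q' ++ r)) t ∧
      Relation.ReflGen (Up g) (p ++ (c ++ (d' ++ e))) t := by
  obtain ⟨z, w, rfl⟩ : ∃ z w, q = [z, w] := by
    obtain ⟨_, _, _, _, rfl, -⟩ := h1; exact ⟨_, _, rfl⟩
  have hd : ∃ z w, d = [z, w] := by
    obtain ⟨_, _, _, _, rfl, -⟩ := h2; exact ⟨_, _, rfl⟩
  rcases c with _ | ⟨y, _ | ⟨y', c⟩⟩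
  · obtain ⟨z', w', rfl⟩ := hd
    simp only [List.append_nil, List.nil_append, List.cons_append, List.cons.injEq] at he h2
    obtain ⟨rfl, rfl, rfl⟩ := he
    obtain rfl := h1.unique h2
    exact ⟨_, .refl, .refl⟩
  · exfalso
    obtain ⟨z', w', rfl⟩ := hd
    simp only [List.nil_append, List.cons_append, List.cons.injEq] at he
    obtain ⟨rfl, rfl, rfl⟩ := he
    rw [endOf_append] at h2
    exact h1.not_overlap h2
  · simp only [List.nil_append, List.cons_append, List.cons.injEq] at he
    obtain ⟨rfl, rfl, rfl⟩ := he
    have hu : Up g (p ++ ([z, w] ++ (c ++ (d ++ e)))) (p ++ (q' ++ (c ++ (d ++ e)))) :=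
      up_iff.2 ⟨hl, _, _, _, _, rfl, rfl, h1⟩
    have hu2 : Up g (p ++ ([z, w] ++ (c ++ (d ++ e)))) (p ++ ([z, w] ++ (c ++ (d' ++ e)))) :=
      up_iff.2 ⟨hl, p ++ ([z, w] ++ c), d, d', e, by simp, by simp, h2⟩
    have hl1 := (hu.path_iff.1 ⟨hl, rfl⟩).1
    have hl2 := (hu2.path_iff.1 ⟨hl, rfl⟩).1
    refine ⟨p ++ (q' ++ (c ++ (d' ++ e))), .single (up_iff.2 ⟨hl1, p ++ (q' ++ c), d, d', e,
      by simp, by simp, ?_⟩), .single (up_iff.2 ⟨hl2, p, [z, w], q', c ++ (d' ++ e), rfl, rfl, h1⟩)⟩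
    -- The first replacement preserves the endpoint of its factor, so the second one still starts at
    -- the same letter.
    have e1 : endOf g (p ++ z :: w :: c) = endOf g (p ++ (q' ++ c)) := by
      rw [show z :: w :: c = [z, w] ++ c from rfl]
      simp only [endOf_append, h1.endOf_eq]
    rwa [← e1]

theorem up_diamond {g : GPrime} {s t t' : List (Anchor × GPrime)} (h : Up g s t)
    (h' : Up g s t') : ∃ u, Relation.ReflGen (Up g) t u ∧ Relation.ReflGen (Up g) t' u := by
  obtain ⟨hl, p, q, q', r, rfl, rfl, h1⟩ := up_iff.1 h
  obtain ⟨-, b, d, d', e, he, rfl, h2⟩ := up_iff.1 h'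
  rcases List.append_eq_append_iff.1 he with ⟨c, rfl, h3⟩ | ⟨c, rfl, h3⟩
  · simpa using up_diamond_aux hl h1 h2 h3
  · obtain ⟨u, h4, h5⟩ := up_diamond_aux (he ▸ hl) h2 h1 h3
    exact ⟨u, by simpa using h5, h4⟩

/-- Convertibility of landscapes: the equivalence generated by upliftings. -/
def Conv (g : GPrime) : List (Anchor × GPrime) → List (Anchor × GPrime) → Prop :=
  Relation.EqvGen (Up g)

/-- The diamond closes with at most one step on each side, so the Church–Rosser property needs no
termination argument. -/
theorem Conv.join {g : GPrime} {s t : List (Anchor × GPrime)} (h : Conv g s t) :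
    Relation.Join (Relation.ReflTransGen (Up g)) s t := by
  have he : Equivalence (Relation.Join (Relation.ReflTransGen (Up g))) :=
    Relation.equivalence_join_reflTransGen fun a b c hab hac => by
      obtain ⟨d, h1, h2⟩ := up_diamond hab hac
      exact ⟨d, h1, h2.to_reflTransGen⟩
  exact he.eqvGen_iff.1 (h.mono fun a b hab => ⟨b, .single hab, .refl⟩)

theorem Conv.refl (g : GPrime) (s : List (Anchor × GPrime)) : Conv g s s :=
  Relation.EqvGen.refl _

theorem Conv.symm {g : GPrime} {s t : List (Anchor × GPrime)} (h : Conv g s t) : Conv g t s :=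
  Relation.EqvGen.symm _ _ h

theorem Conv.trans {g : GPrime} {s t u : List (Anchor × GPrime)} (h : Conv g s t)
    (h' : Conv g t u) : Conv g s u := Relation.EqvGen.trans _ _ _ h h'

theorem Conv.of_reflTransGen {g : GPrime} {s t : List (Anchor × GPrime)}
    (h : Relation.ReflTransGen (Up g) s t) : Conv g s t := by
  induction h with
  | refl => exact .refl _ _
  | tail _ h ih => exact ih.trans (Relation.EqvGen.rel _ _ h)

theorem Conv.path_iff {g h : GPrime} {s t : List (Anchor × GPrime)} (hu : Conv g s t) :
    Path g s h ↔ Path g t h := by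
  induction hu with
  | rel _ _ h => exact h.path_iff
  | refl => rfl
  | symm _ _ _ ih => exact ih.symm
  | trans _ _ _ _ _ ih ih' => exact ih.trans ih'

theorem Conv.append_left {g h : GPrime} {s t p : List (Anchor × GPrime)} (hu : Conv h s t)
    (hp : Path g p h) : Conv g (p ++ s) (p ++ t) := by
  induction hu with
  | rel _ _ h => exact .rel _ _ (h.append_left hp)
  | refl => exact .refl _ _
  | symm _ _ _ ih => exact ih.symm
  | trans _ _ _ _ _ ih ih' => exact ih.trans ih'

theorem Conv.append_right {g h k : GPrime} {s t p : List (Anchor × GPrime)} (hu : Conv g s t)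
    (hs : Path g s h) (hp : Path h p k) : Conv g (s ++ p) (t ++ p) := by
  induction hu with
  | rel _ _ h => exact .rel _ _ (h.append_right hs hp)
  | refl => exact .refl _ _
  | symm _ _ h ih => exact (ih ((Conv.path_iff h).2 hs)).symm
  | trans _ _ _ h _ ih ih' => exact (ih hs).trans (ih' ((Conv.path_iff h).1 hs))

theorem Conv.append {g h k : GPrime} {s s' t t' : List (Anchor × GPrime)} (h1 : Conv g s s')
    (h2 : Conv h t t') (hs : Path g s h) (ht : Path h t k) : Conv g (s ++ t) (s' ++ t') :=
  (h1.append_right hs ht).trans (h2.append_left (h1.path_iff.1 hs))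

theorem conv_cancel {m h : GPrime} {a : Anchor} (hs : Side m a h) :
    Conv h [(a.inv, m), (a, h)] [] := by
  have hs' : Side m a.inv.inv h := by rwa [Anchor.inv_inv]
  exact .rel _ _ (up_iff.2 ⟨⟨Or.inr hs', Or.inl hs, trivial⟩, [], _, [], [], rfl, rfl,
    a.inv, m, a, h, rfl, hs', hs, Or.inl ⟨rfl, rfl, rfl⟩⟩)

/-- The new letter reads the landscape from right to left: its right side precedes the river and its
left side follows it. -/
theorem conv_uplift {k l c r : GPrime} {la ra : Anchor} (h : IsTup k l la c ra r) :
    Conv r [(ra, c), (la.inv, l)] [(ra, k), (la.inv, l)] := by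
  refine .rel _ _ (up_iff.2 ⟨⟨Or.inr h.right, Or.inl h.left, trivial⟩, [], _, _, [], rfl, rfl,
    ra, c, la.inv, l, rfl, h.right, h.left, Or.inr ⟨?_, k, ?_, rfl⟩⟩)
  · rw [Anchor.inv_inv]
    exact fun e => h.ne ⟨e.1.symm, e.2.symm⟩
  · rwa [Anchor.inv_inv]

theorem exists_rule {g m h : GPrime} {a b : Anchor} (h1 : Side m a.inv g) (h2 : Side m b h) :
    ∃ t, Rule g [(a, m), (b, h)] t := by
  by_cases e : g = h ∧ a = b.inv
  · exact ⟨_, a, m, b, h, rfl, h1, h2, Or.inl ⟨e.1, e.2, rfl⟩⟩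
  · obtain ⟨k, hk⟩ := exists_isTup (l := h) (la := b.inv) (by rwa [Anchor.inv_inv]) h1
      fun e' => e ⟨e'.1.symm, e'.2.symm⟩
    exact ⟨_, a, m, b, h, rfl, h1, h2, Or.inr ⟨e, k, hk, rfl⟩⟩

theorem exists_up {g : GPrime} {s : List (Anchor × GPrime)} (hs : Along Anchored g s)
    (hr : ¬ (AltWord.mk g s).NoRiver) : ∃ t, Up g s t := by
  simp only [AltWord.NoRiver, not_forall, not_not] at hr
  obtain ⟨p, a, m, b, h, r, h1, h2, h3⟩ := hr
  simp only at h1 h2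
  subst h1
  have hl := ((along_append _ _ _).1 hs).2
  obtain ⟨t, ht⟩ := exists_rule (hl.1.side' h2) (hl.2.1.side h3)
  exact ⟨_, up_iff.2 ⟨hs, p, _, t, r, rfl, rfl, ht⟩⟩

theorem not_up_of_noRiver {g : GPrime} {s t : List (Anchor × GPrime)}
    (hr : (AltWord.mk g s).NoRiver) : ¬ Up g s t := by
  rintro ⟨-, p, a, m, b, h, r, h1, -⟩
  exact hr _ _ _ _ _ _ h1

theorem height_endOf_le : ∀ (s : List (Anchor × GPrime)) (g : GPrime), Along Anchored g s →
    (endOf g s).height ≤ g.height + s.length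
  | [], _, _ => le_rfl
  | (a, h) :: s, g, hs => by
    have := height_endOf_le s h hs.2
    rcases hs.1.height with h1 | h1 <;> simp only [endOf, List.length_cons] <;> omega

/-- A quantity that decreases with each uplifting. -/
def depth (N : ℕ) (s : List (Anchor × GPrime)) : ℕ := (s.map fun q => N + 1 - q.2.height).sum

theorem depth_mono {N M : ℕ} (h : N ≤ M) : ∀ s : List (Anchor × GPrime), depth N s ≤ depth M s
  | [] => le_rfl
  | q :: s => by
    have := depth_mono h s
    simp only [depth, List.map_cons, List.sum_cons] at this ⊢
    omega

/-- The bound `g.height + length` dominates all heights, since a step climbs by at most one. Raising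
a river adds two to a height under an unchanged bound. Removing one deletes two summands, the
river's being positive, and the smaller bound can only decrease the others. -/
theorem Up.depth_lt {g : GPrime} {s t : List (Anchor × GPrime)} (hu : Up g s t) :
    depth (g.height + t.length) t < depth (g.height + s.length) s := by
  obtain ⟨hl, p, q, q', r, rfl, rfl, a, m, b, h, rfl, s1, s2, h4⟩ := up_iff.1 hu
  have hp := height_endOf_le p g ((along_append _ _ _).1 hl).1
  have e1 := s1.height
  rcases h4 with ⟨-, -, rfl⟩ | ⟨-, k, hk, rfl⟩
  · have hle : g.height + (p ++ ([] ++ r)).length ≤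
        g.height + (p ++ ([(a, m), (b, h)] ++ r)).length := by
      simp only [List.length_append, List.length_cons, List.length_nil]; omega
    have h1 := depth_mono hle p
    have h2 := depth_mono hle r
    simp only [depth, List.map_append, List.sum_append, List.map_cons, List.map_nil,
      List.sum_cons, List.sum_nil] at h1 h2 ⊢
    have : 0 < g.height + (p ++ ([(a, m), (b, h)] ++ r)).length + 1 - m.height := by
      simp only [List.length_append]; omega
    omega
  · have e2 := hk.height_eq
    simp only [depth, List.map_append, List.sum_append, List.map_cons, List.map_nil,
      List.sum_cons, List.sum_nil, List.length_append, List.length_cons, List.length_nil]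
    omega

theorem exists_normalForm {g : GPrime} (s : List (Anchor × GPrime)) (hs : Along Anchored g s) :
    ∃ t, Relation.ReflTransGen (Up g) s t ∧ (AltWord.mk g t).NoRiver := by
  induction hn : depth (g.height + s.length) s using Nat.strong_induction_on generalizing s with
  | _ n ih =>
    by_cases hr : (AltWord.mk g s).NoRiver
    · exact ⟨s, .refl, hr⟩
    · obtain ⟨t, ht⟩ := exists_up hs hr
      obtain ⟨u, h1, h2⟩ := ih _ (hn ▸ ht.depth_lt) t (ht.path_iff.1 ⟨hs, rfl⟩).1 rfl
      exact ⟨u, .head ht h1, h2⟩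

theorem eq_of_reflTransGen_of_noRiver {g : GPrime} {s t : List (Anchor × GPrime)}
    (hr : (AltWord.mk g s).NoRiver) (h : Relation.ReflTransGen (Up g) s t) : s = t := by
  rcases h.cases_head with h | ⟨u, h, -⟩
  · exact h
  · exact (not_up_of_noRiver hr h).elim

theorem Conv.reflTransGen {g : GPrime} {s t : List (Anchor × GPrime)} (h : Conv g s t)
    (hr : (AltWord.mk g t).NoRiver) : Relation.ReflTransGen (Up g) s t := by
  obtain ⟨u, h1, h2⟩ := h.join
  rwa [eq_of_reflTransGen_of_noRiver hr h2]

end Rewriting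


/-! ### The monoid of mountains. -/

section MountainMonoid

theorem reflTransGen_uplift_iff {g : GPrime} {s : List (Anchor × GPrime)} {w : AltWord} :
    Relation.ReflTransGen AltWord.Uplift ⟨g, s⟩ w ↔
      w.head = g ∧ Relation.ReflTransGen (Up g) s w.steps := by
  constructor
  · intro h
    induction h with
    | refl => exact ⟨rfl, .refl⟩
    | @tail u v _ h ih =>
      obtain ⟨ih1, ih2⟩ := ih
      have hv : v.head = u.head := by
        obtain ⟨-, _, _, _, _, _, _, -, ⟨-, -, rfl⟩ | ⟨-, _, -, rfl⟩⟩ := h <;> rfl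
      refine ⟨hv.trans ih1, ih2.tail ?_⟩
      obtain ⟨_, _⟩ := u
      obtain ⟨_, _⟩ := v
      subst ih1
      obtain rfl := hv
      exact h
  · rintro ⟨rfl, h⟩
    have : ∀ t, Relation.ReflTransGen (Up w.head) s t →
        Relation.ReflTransGen AltWord.Uplift ⟨w.head, s⟩ ⟨w.head, t⟩ :=
      fun t ht => ht.lift (AltWord.mk w.head) fun _ _ h => h
    exact this _ h

namespace Mountain

theorem path (u : Mountain) : Path GPrime.one u.word.steps GPrime.one := by
  have h1 := u.landscape
  have h2 := u.last_eq
  rw [AltWord.IsLandscape, u.head_eq] at h1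
  rw [AltWord.last, u.head_eq] at h2
  exact ⟨h1, h2⟩

theorem word_eq (u : Mountain) : u.word = ⟨GPrime.one, u.word.steps⟩ := by
  rw [← u.head_eq]

theorem noRiver' (u : Mountain) : (AltWord.mk GPrime.one u.word.steps).NoRiver := by
  rw [← u.word_eq]; exact u.noRiver

/-- A landscape without rivers from `1` to `1`, as a mountain. -/
def ofPath (s : List (Anchor × GPrime)) (h : Path GPrime.one s GPrime.one)
    (hr : (AltWord.mk GPrime.one s).NoRiver) : Mountain where
  word := ⟨GPrime.one, s⟩
  landscape := h.1
  head_eq := rfl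
  last_eq := h.2
  noRiver := hr

theorem exists_reduction {s : List (Anchor × GPrime)} (h : Path GPrime.one s GPrime.one) :
    ∃ u : Mountain, Relation.ReflTransGen (Up GPrime.one) s u.word.steps := by
  obtain ⟨t, ht, hr⟩ := exists_normalForm s h.1
  exact ⟨ofPath t ((Conv.of_reflTransGen ht).path_iff.1 h) hr, ht⟩

theorem exists_conv {s : List (Anchor × GPrime)} (h : Path GPrime.one s GPrime.one) :
    ∃ u : Mountain, Conv GPrime.one s u.word.steps :=
  (exists_reduction h).imp fun _ => Conv.of_reflTransGen

theorem eq_of_conv {u v : Mountain} (h : Conv GPrime.one u.word.steps v.word.steps) : u = v := by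
  refine Mountain.ext ?_
  rw [u.word_eq, v.word_eq,
    eq_of_reflTransGen_of_noRiver u.noRiver' (h.reflTransGen v.noRiver')]

theorem reduces_iff_conv {u v w : Mountain} :
    Relation.ReflTransGen AltWord.Uplift (u.word.star v.word) w.word ↔
      Conv GPrime.one (u.word.steps ++ v.word.steps) w.word.steps := by
  rw [AltWord.star, u.head_eq, reflTransGen_uplift_iff]
  exact ⟨fun h => .of_reflTransGen h.2, fun h => ⟨w.head_eq, h.reflTransGen w.noRiver'⟩⟩

theorem conv_mul (u v : Mountain) :
    Conv GPrime.one (u.word.steps ++ v.word.steps) (u * v).word.steps := by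
  rw [← reduces_iff_conv]
  have : ∃ w : Mountain, Relation.ReflTransGen AltWord.Uplift (u.word.star v.word) w.word := by
    simpa only [reduces_iff_conv] using exists_conv (u.path.append v.path)
  exact Classical.epsilon_spec this

/-- This characterization replaces the choice made in the definition of `⊙`: products are computed
by converting a concatenation into a mountain. -/
theorem conv_mul_iff {u v w : Mountain} :
    Conv GPrime.one (u.word.steps ++ v.word.steps) w.word.steps ↔ w = u * v :=
  ⟨fun h => eq_of_conv (h.symm.trans (conv_mul u v)), by rintro rfl; exact conv_mul u v⟩

instance : One Mountain := ⟨trivial⟩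

noncomputable instance : Monoid Mountain where
  mul_assoc u v w := by
    refine eq_of_conv (((conv_mul (u * v) w).symm.trans ?_).trans (conv_mul u (v * w)))
    refine ((conv_mul u v).symm.append_right (u * v).path w.path).trans ?_
    rw [List.append_assoc]
    exact (conv_mul v w).append_left u.path
  one_mul u := (conv_mul_iff.1 (Conv.refl _ _)).symm
  mul_one u := (conv_mul_iff.1 (by
    rw [show (1 : Mountain).word.steps = [] from rfl, List.append_nil]
    exact Conv.refl _ _)).symm

end Mountain

end MountainMonoid

/-! ### Canonical hills, and contraction of anchored triplets. -/

section CanonicalPaths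

theorem Letter.left_mem {l c r : Letter} {la ra : Anchor} (h : Letter.tup l la c ra r ∈ G') :
    l ∈ G' := by
  rcases cases_of_mem_G' h with h | h | ⟨_, _, _, _, _, h, hl, -⟩
  · cases h
  · cases h; exact Or.inl rfl
  · cases h; exact hl

theorem Letter.right_mem {l c r : Letter} {la ra : Anchor} (h : Letter.tup l la c ra r ∈ G') :
    r ∈ G' := by
  rcases cases_of_mem_G' h with h | h | ⟨_, _, _, _, _, h, -, -, hr, -⟩
  · cases h
  · cases h; exact Or.inl rfl
  · cases h; exact hr

open Classical in
/-- The canonical uphill from `1` to a letter. -/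
noncomputable def Letter.upPath : (g : Letter) → g ∈ Letter.G' → List (Anchor × GPrime)
  | .anchor _, _ => []
  | .tup l la c _ _, h =>
    -- The relation `left` read as a climb through the centre. Within `G'`, only `g_{xx'}` has a
    -- centre outside `G'`, namely `x`, and its climb is a single step.
    (if hc : c ∈ Letter.G' then Letter.upPath c hc ++ [(la.inv, ⟨l, left_mem h⟩)] else []) ++
      [(la, ⟨_, h⟩)]

open Classical in
/-- The canonical downhill from a letter to `1`. -/
noncomputable def Letter.downPath : (g : Letter) → g ∈ Letter.G' → List (Anchor × GPrime)
  | .anchor _, _ => []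
  | .tup _ _ c ra r, h =>
    if hc : c ∈ Letter.G' then
      (ra.inv, ⟨r, right_mem h⟩) :: (ra, ⟨c, hc⟩) :: Letter.downPath c hc
    -- The descent from `g_{xx'}` uses its left anchor `1`; the step with anchor `x`, the inverse of
    -- the right one, would turn the represented element into `xx'x = x`.
    else [(.one, GPrime.one)]

namespace GPrime

/-- The canonical uphill from `1` to a letter of `G'`. -/
noncomputable def upPath (g : GPrime) : List (Anchor × GPrime) := Letter.upPath g.1 g.2

/-- The canonical downhill from a letter of `G'` to `1`. -/
noncomputable def downPath (g : GPrime) : List (Anchor × GPrime) := Letter.downPath g.1 g.2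

theorem upPath_one : one.upPath = [] := rfl

theorem downPath_one : one.downPath = [] := rfl

theorem anchor_notMem_level (a : Anchor) (i : ℕ) : Letter.anchor a ∉ Letter.Level i := by
  intro h
  obtain rfl : 0 = i := Letter.height_of_mem_level i _ h
  simp [Letter.Level, Letter.Ge, Letter.Gd] at h

theorem anchor_x_notMem : Letter.anchor .x ∉ Letter.G' := by
  rintro (h | ⟨i, h⟩)
  · cases h
  · exact anchor_notMem_level _ _ h

theorem upPath_gxx : gxx.upPath = [(.one, gxx)] := by
  simp only [upPath, gxx, Letter.gxx, Letter.upPath, dif_neg anchor_x_notMem, List.nil_append]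

theorem downPath_gxx : gxx.downPath = [(.one, one)] := by
  simp only [downPath, gxx, Letter.gxx, Letter.downPath, dif_neg anchor_x_notMem]

end GPrime

namespace IsTup

variable {g l c r : GPrime} {la ra : Anchor}

theorem upPath_eq (h : IsTup g l la c ra r) :
    g.upPath = c.upPath ++ [(la.inv, l), (la, g)] := by
  obtain ⟨g, hg⟩ := g
  obtain rfl : g = _ := h.eq
  simp only [GPrime.upPath, Letter.upPath, dif_pos c.2, List.append_assoc, List.cons_append,
    List.nil_append]

theorem downPath_eq (h : IsTup g l la c ra r) :
    g.downPath = (ra.inv, r) :: (ra, c) :: c.downPath := by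
  obtain ⟨g, hg⟩ := g
  obtain rfl : g = _ := h.eq
  simp only [GPrime.downPath, Letter.downPath, dif_pos c.2]

theorem anchored_up_left (h : IsTup g l la c ra r) : Anchored c la.inv l := Or.inl h.left

theorem anchored_up (h : IsTup g l la c ra r) : Anchored l la g := Or.inl h.sideLeft

theorem anchored_down (h : IsTup g l la c ra r) : Anchored g ra.inv r :=
  Or.inr (by rw [Anchor.inv_inv]; exact h.sideRight)

theorem anchored_down_right (h : IsTup g l la c ra r) : Anchored r ra c := Or.inr h.right

end IsTup

theorem GPrime.induction {P : GPrime → Prop} (one : P GPrime.one) (gxx : P GPrime.gxx)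
    (tup : ∀ g l la c ra r, IsTup g l la c ra r → P l → P c → P r → P g) (g : GPrime) : P g := by
  induction hn : g.height using Nat.strong_induction_on generalizing g with
  | _ n ih =>
    rcases g.cases with rfl | rfl | ⟨l, la, c, ra, r, h⟩
    · exact one
    · exact gxx
    · have h1 := h.sideLeft.height
      have h2 := h.sideRight.height
      have h3 := h.height_eq
      exact tup g l la c ra r h (ih _ (by omega) l rfl) (ih _ (by omega) c rfl)
        (ih _ (by omega) r rfl)

theorem side_one_gxx : Side GPrime.one .one GPrime.gxx := side_gxx_iff.2 ⟨rfl, Or.inl rfl⟩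

theorem side_one_gxx' : Side GPrime.one .x' GPrime.gxx := side_gxx_iff.2 ⟨rfl, Or.inr rfl⟩

theorem GPrime.path_upPath (g : GPrime) : Path GPrime.one g.upPath g := by
  induction g using GPrime.induction with
  | one => exact .nil _
  | gxx => rw [upPath_gxx]; exact .single (Or.inl side_one_gxx)
  | tup g l la c ra r h _ ih _ =>
    rw [h.upPath_eq]
    exact ih.append (.cons h.anchored_up_left (.single h.anchored_up))

theorem GPrime.path_downPath (g : GPrime) : Path g g.downPath GPrime.one := by
  induction g using GPrime.induction with
  | one => exact .nil _
  | gxx => rw [downPath_gxx]; exact .single (Or.inr side_one_gxx)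
  | tup g l la c ra r h _ ih _ =>
    rw [h.downPath_eq]
    exact .cons h.anchored_down (.cons h.anchored_down_right ih)

/-- The mountain of an anchor, as a list of steps. -/
def Anchor.toPath : Anchor → List (Anchor × GPrime)
  | .one => []
  -- These landscapes express `x = g_{xx'} x` and `x' = x' g_{xx'}`.
  | .x => [(.one, GPrime.gxx), (.x, GPrime.one)]
  | .x' => [(.x', GPrime.gxx), (.one, GPrime.one)]

theorem Anchor.path_toPath : ∀ a : Anchor, Path GPrime.one a.toPath GPrime.one
  | .one => .nil _
  | .x => .cons (Or.inl side_one_gxx) (.single (Or.inr side_one_gxx'))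
  | .x' => .cons (Or.inl side_one_gxx') (.single (Or.inr side_one_gxx))

theorem Conv.cons {g m : GPrime} {a : Anchor} {s t : List (Anchor × GPrime)} (h : Conv m s t)
    (ha : Anchored g a m) : Conv g ((a, m) :: s) ((a, m) :: t) :=
  h.append_left (p := [(a, m)]) (.single ha)

theorem conv_cancel_append {m h k : GPrime} {a : Anchor} {s : List (Anchor × GPrime)}
    (hs : Side m a h) (hp : Path h s k) : Conv h ((a.inv, m) :: (a, h) :: s) s :=
  (conv_cancel hs).append_right
    (.cons (Or.inr (by rwa [Anchor.inv_inv])) (.single (Or.inl hs))) hp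

theorem conv_cancel_append' {m h k : GPrime} {a : Anchor} {s : List (Anchor × GPrime)}
    (hs : Side m a.inv h) (hp : Path h s k) : Conv h ((a, m) :: (a.inv, h) :: s) s := by
  simpa only [Anchor.inv_inv] using conv_cancel_append hs hp

theorem conv_uplift_append {k l c r m : GPrime} {la ra : Anchor} {s : List (Anchor × GPrime)}
    (h : IsTup k l la c ra r) (hp : Path l s m) :
    Conv r ((ra, c) :: (la.inv, l) :: s) ((ra, k) :: (la.inv, l) :: s) :=
  (conv_uplift h).append_right
    (.cons h.anchored_down_right (.single h.anchored_up_left)) hp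

/-- This is what makes `g² = g` hold for landscapes. The parts below `c` cancel by induction, the
river `c` between `r` and `l` is raised to `g`, and then `r` and `l` are rivers between copies of
`g` and cancel. -/
theorem conv_downPath_upPath (g : GPrime) : Conv g (g.downPath ++ g.upPath) [] := by
  induction g using GPrime.induction with
  | one => exact .refl _ _
  | gxx =>
    rw [GPrime.downPath_gxx, GPrime.upPath_gxx]
    exact conv_cancel side_one_gxx
  | tup g l la c ra r h _ ih _ =>
    rw [h.downPath_eq, h.upPath_eq]
    have e : (ra.inv, r) :: (ra, c) :: c.downPath ++ (c.upPath ++ [(la.inv, l), (la, g)]) =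
      (ra.inv, r) :: (ra, c) :: ((c.downPath ++ c.upPath) ++ [(la.inv, l), (la, g)]) := by simp
    rw [e]
    have p : Path c [(la.inv, l), (la, g)] g := .cons h.anchored_up_left (.single h.anchored_up)
    refine (((ih.append_right (c.path_downPath.append c.path_upPath) p).cons
      h.anchored_down_right).cons h.anchored_down).trans ?_
    refine ((conv_uplift_append h (.single h.anchored_up)).cons h.anchored_down).trans ?_
    have a : Anchored g la.inv l := Or.inr (by rw [Anchor.inv_inv]; exact h.sideLeft)
    exact (conv_cancel_append h.sideRight (.cons a (.single h.anchored_up))).trans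
      (conv_cancel h.sideLeft)

/-- The words `g a h` and `h a' g` are equal to the products of their letters, if `g` is a side of
`h` with anchor `a`. -/
theorem conv_side (h : GPrime) : ∀ (g : GPrime) (a : Anchor), Side g a h →
    Conv g (g.downPath ++ (a.toPath ++ h.upPath)) [(a, h)] ∧
    Conv h (h.downPath ++ (a.inv.toPath ++ g.upPath)) [(a.inv, g)] := by
  induction h using GPrime.induction with
  | one => intro g a hs; exact hs.elim
  | gxx =>
    intro g a hs
    obtain ⟨rfl, rfl | rfl⟩ := side_gxx_iff.1 hs
    · rw [GPrime.downPath_gxx, GPrime.upPath_gxx]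
      exact ⟨.refl _ _, .refl _ _⟩
    · rw [GPrime.downPath_gxx, GPrime.upPath_gxx]
      exact ⟨(conv_cancel side_one_gxx).cons (Or.inl side_one_gxx'),
        conv_cancel_append side_one_gxx (.single (Or.inr side_one_gxx'))⟩
  | tup h l la c ra r ht ihl _ ihr =>
    intro g a hs
    have pl : Path c [(la.inv, l), (la, h)] h :=
      .cons ht.anchored_up_left (.single ht.anchored_up)
    have pc : ∀ g : GPrime, ∀ a : Anchor, Path g (g.downPath ++ (a.toPath ++ c.upPath)) c :=
      fun g a => g.path_downPath.append (a.path_toPath.append c.path_upPath)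
    have pc' : ∀ (g : GPrime) (a : Anchor), g.downPath ++ (a.toPath ++ h.upPath) =
        (g.downPath ++ (a.toPath ++ c.upPath)) ++ [(la.inv, l), (la, h)] := by
      intro g a; rw [ht.upPath_eq]; simp
    have pr : ∀ (g : GPrime) (a : Anchor), h.downPath ++ (a.toPath ++ g.upPath) =
        (ra.inv, r) :: (ra, c) :: (c.downPath ++ (a.toPath ++ g.upPath)) := by
      intro g a; rw [ht.downPath_eq]; simp
    have al : Anchored h la.inv l := Or.inr (by rw [Anchor.inv_inv]; exact ht.sideLeft)
    have ar : Anchored c ra.inv r := Or.inl ht.right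
    -- Expanding the hill of `h` exposes its centre, which is a side of `g`. The induction
    -- hypothesis contracts everything between `g` and the centre to one step; the centre is then a
    -- river, which cancels between equal sides or is raised to `h`.
    rcases ht.side_iff.1 hs with ⟨rfl, rfl⟩ | ⟨rfl, rfl⟩
    · constructor
      · rw [pc']
        have := (ihl c a.inv ht.left).2
        rw [Anchor.inv_inv] at this
        exact (this.append_right (pc _ _) pl).trans
          (conv_cancel_append' ht.left (.single ht.anchored_up))
      · rw [pr]
        refine ((((ihl c a.inv ht.left).1.cons ht.anchored_down_right).cons
          ht.anchored_down).trans ((conv_uplift ht).cons ht.anchored_down)).trans ?_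
        exact conv_cancel_append ht.sideRight (.single al)
    · constructor
      · rw [pc']
        have := (ihr c a.inv ht.right).2
        rw [Anchor.inv_inv] at this
        refine (this.append_right (pc _ _) pl).trans ?_
        refine (conv_uplift_append ht (.single ht.anchored_up)).trans ?_
        exact (conv_cancel ht.sideLeft).cons (Or.inl ht.sideRight)
      · rw [pr]
        refine (((ihr c a.inv ht.right).1.cons ht.anchored_down_right).cons
          ht.anchored_down).trans ?_
        have := conv_cancel ht.right
        rw [Anchor.inv_inv] at this
        exact this.cons ht.anchored_down

theorem conv_anchored {g h : GPrime} {a : Anchor} (hs : Anchored g a h) :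
    Conv g (g.downPath ++ (a.toPath ++ h.upPath)) [(a, h)] := by
  rcases hs with hs | hs
  · exact (conv_side h g a hs).1
  · simpa only [Anchor.inv_inv] using (conv_side g h a.inv hs).2

end CanonicalPaths


/-! ### From words to landscapes: the defining relations hold up to convertibility. -/

section WordPaths

theorem GPrime.mem_G5_of_ne_one {g : GPrime} (h : g ≠ GPrime.one) : g.1 ∈ Letter.G5 :=
  g.2.resolve_left fun e => h (Subtype.ext e)

theorem anchor_notMem_G5 (a : Anchor) : Letter.anchor a ∉ Letter.G5 := fun ⟨i, h⟩ =>
  GPrime.anchor_notMem_level a i h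

theorem alphabet_cases (g : Alphabet) :
    (∃ a : Anchor, g = a.toAlphabet) ∨ ∃ k : GPrime, g = k.toAlphabet := by
  rcases g with ⟨g, ⟨a, rfl⟩ | h⟩
  · exact Or.inl ⟨a, rfl⟩
  · exact Or.inr ⟨⟨g, Or.inr h⟩, rfl⟩

open Classical in
/-- A landscape from `1` to `1` that represents a letter of the alphabet. -/
noncomputable def letterPath (g : Alphabet) : List (Anchor × GPrime) :=
  if h : g.1 ∈ Letter.G5 then g.1.upPath (Or.inr h) ++ g.1.downPath (Or.inr h)
  else match g.1 with
    | .anchor a => a.toPath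
    -- Never reached: every 5-tuple of the alphabet lies in `G5`.
    | .tup _ _ _ _ _ => []

theorem letterPath_anchor (a : Anchor) : letterPath a.toAlphabet = a.toPath :=
  dif_neg (anchor_notMem_G5 a)

theorem letterPath_gPrime (g : GPrime) : letterPath g.toAlphabet = g.upPath ++ g.downPath := by
  by_cases h : g = GPrime.one
  · subst h
    exact letterPath_anchor .one
  · exact dif_pos (GPrime.mem_G5_of_ne_one h)

theorem path_letterPath (g : Alphabet) : Path GPrime.one (letterPath g) GPrime.one := by
  rcases alphabet_cases g with ⟨a, rfl⟩ | ⟨k, rfl⟩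
  · rw [letterPath_anchor]; exact a.path_toPath
  · rw [letterPath_gPrime]; exact k.path_upPath.append k.path_downPath

/-- A landscape from `1` to `1` that represents a list of letters of the alphabet. -/
noncomputable def listPath (s : List Alphabet) : List (Anchor × GPrime) := s.flatMap letterPath

theorem listPath_append (s t : List Alphabet) :
    listPath (s ++ t) = listPath s ++ listPath t := List.flatMap_append

theorem path_listPath : ∀ s : List Alphabet, Path GPrime.one (listPath s) GPrime.one
  | [] => .nil _
  | g :: s => (path_letterPath g).append (path_listPath s)

/-- The list of the letters of a word. -/
def wordLetters (w : Word) : List Alphabet := w.head :: w.tail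

theorem wordLetters_mul (v w : Word) : wordLetters (v * w) = wordLetters v ++ wordLetters w := rfl

/-- A landscape from `1` to `1` that represents a word. -/
noncomputable def wordPath (w : Word) : List (Anchor × GPrime) := listPath (wordLetters w)

theorem path_wordPath (w : Word) : Path GPrime.one (wordPath w) GPrime.one := path_listPath _

theorem wordPath_mul (v w : Word) : wordPath (v * w) = wordPath v ++ wordPath w := by
  rw [wordPath, wordLetters_mul, listPath_append]; rfl

theorem wordPath_letter (g : Alphabet) : wordPath (letter g) = letterPath g := by
  simp [wordPath, wordLetters, listPath, letter, FreeSemigroup.of]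

/-- The expansion telescopes. Each inner letter is a climb followed by a descent: the climb is used
up by the triplet on its left, the descent by the one on its right, both through `conv_anchored`.
The leading `g.downPath` is the pending half of the first letter. -/
theorem conv_tailLetters : ∀ (s : List (Anchor × GPrime)) (g k : GPrime), Path g s k →
    Conv g (g.downPath ++ listPath (AltWord.tailLetters s)) (s ++ k.downPath)
  | [], g, k, h => by
    obtain rfl : g = k := h.2
    simpa [AltWord.tailLetters, listPath] using Conv.refl _ _
  | (a, h) :: s, g, k, hp => by
    have hs : Path h s k := ⟨hp.1.2, hp.2⟩
    have ih := conv_tailLetters s h k hs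
    have e : g.downPath ++ listPath (AltWord.tailLetters ((a, h) :: s)) =
        (g.downPath ++ (a.toPath ++ h.upPath)) ++
          (h.downPath ++ listPath (AltWord.tailLetters s)) := by
      simp [AltWord.tailLetters, listPath, letterPath_anchor, letterPath_gPrime]
    rw [e]
    exact (conv_anchored hp.1.1).append ih
      (g.path_downPath.append (a.path_toPath.append h.path_upPath))
      (h.path_downPath.append (path_listPath _))

/-- The landscape that represents the word of a landscape from `g` to `k`. -/
theorem conv_toWord {s : List (Anchor × GPrime)} {g k : GPrime} (h : Path g s k) :
    Conv GPrime.one (wordPath (AltWord.mk g s).toWord) (g.upPath ++ (s ++ k.downPath)) := by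
  have e : wordPath (AltWord.mk g s).toWord =
      g.upPath ++ (g.downPath ++ listPath (AltWord.tailLetters s)) := by
    simp [wordPath, wordLetters, AltWord.toWord, listPath, letterPath_gPrime]
  rw [e]
  exact (conv_tailLetters s g k h).append_left g.path_upPath

theorem Mountain.conv_toWord (u : Mountain) :
    Conv GPrime.one (wordPath u.word.toWord) u.word.steps := by
  have h := WeakGen.conv_toWord u.path
  rw [← u.word_eq] at h
  simpa [GPrime.upPath_one, GPrime.downPath_one] using h

/-- The congruence on words induced by convertibility. -/
noncomputable def wordCon : Con Word where
  r v w := Conv GPrime.one (wordPath v) (wordPath w)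
  iseqv := ⟨fun _ => .refl _ _, .symm, .trans⟩
  mul' {v w x y} h h' := by
    rw [wordPath_mul, wordPath_mul]
    exact h.append h' (path_wordPath _) (path_wordPath _)

theorem exists_gPrime_of_tup {g l c r : Alphabet} {la ra : Anchor}
    (hg : g.1 = .tup l.1 la c.1 ra r.1) (h2 : 2 ≤ g.1.height) :
    ∃ g' l' c' r' : GPrime, g = g'.toAlphabet ∧ l = l'.toAlphabet ∧ c = c'.toAlphabet ∧
      r = r'.toAlphabet ∧ IsTup g' l' la c' ra r' := by
  rcases alphabet_cases g with ⟨a, rfl⟩ | ⟨k, rfl⟩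
  · cases hg
  rcases k.cases with rfl | rfl | ⟨l', la', c', ra', r', h⟩
  · cases hg
  · simp [GPrime.toAlphabet, GPrime.gxx, Letter.gxx, Letter.height, Letter.one] at h2
  · have e : k.1 = .tup l.1 la c.1 ra r.1 := hg
    have e' := h.eq.symm.trans e
    simp only [Letter.tup.injEq] at e'
    obtain ⟨e1, rfl, e2, rfl, e3⟩ := e'
    exact ⟨k, l', c', r', rfl, Subtype.ext e1.symm, Subtype.ext e2.symm, Subtype.ext e3.symm, h⟩

theorem wordPath_anc (a : Anchor) : wordPath (anc a) = a.toPath :=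
  (wordPath_letter _).trans (letterPath_anchor a)

theorem wordPath_gPrime (g : GPrime) :
    wordPath (letter g.toAlphabet) = g.upPath ++ g.downPath :=
  (wordPath_letter _).trans (letterPath_gPrime g)

/-- The longer sides of `left` and `right` are words of landscapes from `c` to `g` and from `g` to
`c`, and adding the canonical hill of `c` gives a canonical hill of `g`. The two sides of `middle`
are words of landscapes that differ by one uplifting. -/
theorem conv_of_rel {v w : Word} (h : Rel v w) :
    Conv GPrime.one (wordPath v) (wordPath w) := by
  have u1 : Anchored GPrime.one .one GPrime.gxx := Or.inl side_one_gxx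
  have u2 : Anchored GPrime.one .x' GPrime.gxx := Or.inl side_one_gxx'
  have d1 : Anchored GPrime.gxx .one GPrime.one := Or.inr side_one_gxx
  have d2 : Anchored GPrime.gxx .x GPrime.one := Or.inr side_one_gxx'
  cases h with
  | xx'x =>
    simp only [wordPath_mul, wordPath_anc, Anchor.toPath, List.cons_append, List.nil_append]
    refine ((conv_cancel_append (k := GPrime.one) side_one_gxx' ?_).cons u1).trans
      ((conv_cancel_append side_one_gxx (.single d2)).cons u1)
    exact .cons d1 (.cons u1 (.single d2))
  | x'xx' =>
    simp only [wordPath_mul, wordPath_anc, Anchor.toPath, List.cons_append, List.nil_append]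
    refine ((conv_cancel_append (k := GPrime.one) side_one_gxx ?_).cons u2).trans
      ((conv_cancel_append side_one_gxx' (.single d1)).cons u2)
    exact .cons d2 (.cons u2 (.single d1))
  | gxx g hg =>
    obtain rfl : g = GPrime.gxx.toAlphabet := Subtype.ext hg
    simp only [wordPath_mul, wordPath_anc, wordPath_gPrime, Anchor.toPath, List.cons_append,
      List.nil_append, GPrime.upPath_gxx, GPrime.downPath_gxx]
    exact ((conv_cancel_append side_one_gxx' (.single d1)).cons u1).symm
  | one_mul g =>
    rw [wordPath_mul, wordPath_anc]
    exact .refl _ _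
  | mul_one g =>
    rw [wordPath_mul, wordPath_anc, Anchor.toPath, List.append_nil]
    exact .refl _ _
  | idem g =>
    rw [wordPath_mul, wordPath_gPrime, List.append_assoc, ← List.append_assoc g.downPath]
    exact ((conv_downPath_upPath g).append_right (g.path_downPath.append g.path_upPath)
      g.path_downPath).append_left g.path_upPath
  | left g l c r la ra hg h2 =>
    obtain ⟨g, l, c, r, rfl, rfl, rfl, rfl, h⟩ := exists_gPrime_of_tup hg h2
    have := conv_toWord (g := c) (.cons h.anchored_up_left (.single h.anchored_up))
    rw [← List.append_assoc, ← h.upPath_eq] at this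
    rw [wordPath_gPrime]
    exact this
  | right g l c r la ra hg h2 =>
    obtain ⟨g, l, c, r, rfl, rfl, rfl, rfl, h⟩ := exists_gPrime_of_tup hg h2
    have := conv_toWord (g := g) (.cons h.anchored_down (.single h.anchored_down_right))
    rw [List.cons_append, List.cons_append, List.nil_append, ← h.downPath_eq] at this
    rw [wordPath_gPrime]
    exact this
  | middle g l c r la ra hg h2 =>
    obtain ⟨g, l, c, r, rfl, rfl, rfl, rfl, h⟩ := exists_gPrime_of_tup hg h2
    have p : Path r [(ra, c), (la.inv, l)] l :=
      .cons h.anchored_down_right (.single h.anchored_up_left)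
    have q : Path r [(ra, g), (la.inv, l)] l := (conv_uplift h).path_iff.1 p
    refine (conv_toWord q).trans (Conv.trans ?_ (conv_toWord p).symm)
    exact ((conv_uplift h).symm.append_right q l.path_downPath).append_left r.path_upPath

theorem conv_of_cls_eq {v w : Word} (h : cls v = cls w) :
    Conv GPrime.one (wordPath v) (wordPath w) := by
  have h1 : conGen Rel ≤ wordCon := Con.conGen_le.2 fun _ _ => conv_of_rel
  exact h1 ((Con.eq _).1 h)

end WordPaths

/-! ### From landscapes to `F11`, and the isomorphism. -/

section Evaluation

theorem cls_mul (v w : Word) : cls (v * w) = cls v * cls w := rfl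

theorem cls_eq_of_rel {v w : Word} (h : Rel v w) : cls v = cls w :=
  (Con.eq _).2 (ConGen.Rel.of _ _ h)

/-- The class of a letter of `G'`. -/
def GPrime.val (g : GPrime) : F11 := cls (letter g.toAlphabet)

/-- The class of an anchor. -/
def Anchor.val (a : Anchor) : F11 := cls (anc a)

theorem GPrime.val_mul_self (g : GPrime) : g.val * g.val = g.val := cls_eq_of_rel (.idem g)

theorem GPrime.val_mul_self_assoc (g : GPrime) (c : F11) : g.val * (g.val * c) = g.val * c := by
  rw [← mul_assoc, g.val_mul_self]

theorem one_val_mul_cls (w : Word) : GPrime.one.val * cls w = cls w := by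
  have h : ∀ g : Alphabet, GPrime.one.val * cls (letter g) = cls (letter g) :=
    fun g => cls_eq_of_rel (.one_mul g)
  induction w using FreeSemigroup.recOnMul with
  | ih1 g => exact h g
  | ih2 g w h1 _ => rw [cls_mul, ← mul_assoc, h1]

theorem cls_mul_one_val (w : Word) : cls w * GPrime.one.val = cls w := by
  have h : ∀ g : Alphabet, cls (letter g) * GPrime.one.val = cls (letter g) :=
    fun g => cls_eq_of_rel (.mul_one g)
  induction w using FreeSemigroup.recOnMul with
  | ih1 g => exact h g
  | ih2 g w _ h1 => rw [cls_mul, mul_assoc, h1]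

theorem GPrime.one_val_mul (c : F11) : GPrime.one.val * c = c := by
  induction c using Con.induction_on with
  | H w => exact one_val_mul_cls w

theorem GPrime.mul_one_val (c : F11) : c * GPrime.one.val = c := by
  induction c using Con.induction_on with
  | H w => exact cls_mul_one_val w

theorem Anchor.one_val : Anchor.one.val = GPrime.one.val := rfl

theorem Anchor.x_val_mul : Anchor.x.val * Anchor.x'.val * Anchor.x.val = Anchor.x.val :=
  cls_eq_of_rel .xx'x

theorem Anchor.x'_val_mul : Anchor.x'.val * Anchor.x.val * Anchor.x'.val = Anchor.x'.val :=
  cls_eq_of_rel .x'xx'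

theorem GPrime.gxx_val : GPrime.gxx.val = Anchor.x.val * Anchor.x'.val :=
  cls_eq_of_rel (.gxx _ rfl)

namespace IsTup

variable {g l c r : GPrime} {la ra : Anchor}

theorem two_le_height (h : IsTup g l la c ra r) : 2 ≤ g.1.height :=
  (Nat.le_add_left 2 c.height).trans_eq h.height_eq.symm

theorem val_left (h : IsTup g l la c ra r) :
    c.val * (la.inv.val * (l.val * (la.val * g.val))) = g.val := by
  simp only [← mul_assoc]
  exact cls_eq_of_rel (.left g.toAlphabet l.toAlphabet c.toAlphabet r.toAlphabet la ra h.eq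
    h.two_le_height)

theorem val_right (h : IsTup g l la c ra r) :
    g.val * (ra.inv.val * (r.val * (ra.val * c.val))) = g.val := by
  simp only [← mul_assoc]
  exact cls_eq_of_rel (.right g.toAlphabet l.toAlphabet c.toAlphabet r.toAlphabet la ra h.eq
    h.two_le_height)

theorem val_middle (h : IsTup g l la c ra r) :
    r.val * (ra.val * (c.val * (la.inv.val * l.val))) =
      r.val * (ra.val * (g.val * (la.inv.val * l.val))) := by
  simp only [← mul_assoc]
  exact (cls_eq_of_rel (.middle g.toAlphabet l.toAlphabet c.toAlphabet r.toAlphabet la ra h.eq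
    h.two_le_height)).symm

/-- Since `c` is idempotent, multiplying the right relation by the left one gives `g (ra' r ra) c
(la' l la) g = g g = g`. Absorbing the part up to `c` into the first `g` by `right` yields one
identity; absorbing the part from `c` on into the last `g` by `left` yields the other. -/
theorem val_cancel (h : IsTup g l la c ra r) :
    g.val * (la.inv.val * (l.val * (la.val * g.val))) = g.val ∧
      g.val * (ra.inv.val * (r.val * (ra.val * g.val))) = g.val := by
  have key : g.val * (ra.inv.val * (r.val * (ra.val * (c.val *
      (la.inv.val * (l.val * (la.val * g.val))))))) = g.val := by
    rw [h.val_left]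
    have h1 := h.val_right
    have h2 := h.val_left
    calc g.val * (ra.inv.val * (r.val * (ra.val * g.val)))
        = g.val * (ra.inv.val * (r.val * (ra.val * (c.val *
          (la.inv.val * (l.val * (la.val * g.val))))))) := by rw [h2]
      _ = g.val * (ra.inv.val * (r.val * (ra.val * (c.val * (c.val *
          (la.inv.val * (l.val * (la.val * g.val)))))))) := by rw [c.val_mul_self_assoc]
      _ = g.val * (ra.inv.val * (r.val * (ra.val * c.val))) * (c.val *
          (la.inv.val * (l.val * (la.val * g.val)))) := by simp only [mul_assoc]
      _ = g.val := by rw [h1, h2, g.val_mul_self]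
  constructor
  · have e : g.val * (ra.inv.val * (r.val * (ra.val * (c.val *
      (la.inv.val * (l.val * (la.val * g.val))))))) =
      g.val * (ra.inv.val * (r.val * (ra.val * c.val))) *
        (la.inv.val * (l.val * (la.val * g.val))) := by simp only [mul_assoc]
    rwa [e, h.val_right] at key
  · rwa [h.val_left] at key

end IsTup

theorem val_cancel_of_side {m h : GPrime} {a : Anchor} (hs : Side m a h) :
    h.val * (a.inv.val * (m.val * (a.val * h.val))) = h.val := by
  rcases h.cases with rfl | rfl | ⟨l, la, c, ra, r, ht⟩
  · exact hs.elim
  · obtain ⟨rfl, rfl | rfl⟩ := side_gxx_iff.1 hs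
    · rw [show Anchor.one.inv = .one from rfl, Anchor.one_val]
      simp only [GPrime.one_val_mul, GPrime.val_mul_self]
    · rw [show Anchor.x'.inv = .x from rfl, GPrime.one_val_mul, GPrime.gxx_val]
      have h1 := Anchor.x_val_mul
      simp only [← mul_assoc, h1]
  · rcases ht.side_iff.1 hs with ⟨rfl, rfl⟩ | ⟨rfl, rfl⟩
    · exact ht.val_cancel.1
    · exact ht.val_cancel.2

/-- The class of the word of a landscape from `g` with steps `s`. -/
def ev (g : GPrime) (s : List (Anchor × GPrime)) : F11 := cls (AltWord.mk g s).toWord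

theorem ev_nil (g : GPrime) : ev g [] = g.val := rfl

theorem ev_cons (g h : GPrime) (a : Anchor) (s : List (Anchor × GPrime)) :
    ev g ((a, h) :: s) = g.val * (a.val * ev h s) := rfl

theorem val_mul_ev (g : GPrime) : ∀ s : List (Anchor × GPrime), g.val * ev g s = ev g s
  | [] => g.val_mul_self
  | (a, h) :: s => by rw [ev_cons, g.val_mul_self_assoc]

/-- The letter at the junction is evaluated twice on the right, which is harmless because it is
idempotent. -/
theorem ev_append : ∀ (s : List (Anchor × GPrime)) (g : GPrime) (t : List (Anchor × GPrime)),
    ev g (s ++ t) = ev g s * ev (endOf g s) t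
  | [], g, t => (val_mul_ev g t).symm
  | (a, h) :: s, g, t => by
    rw [List.cons_append, ev_cons, ev_cons, ev_append s h t, endOf, mul_assoc, mul_assoc]

theorem ev_eq_of_rule {g : GPrime} {s t : List (Anchor × GPrime)} (h : Rule g s t) :
    ev g s = ev g t := by
  obtain ⟨a, m, b, h, rfl, s1, -, ⟨rfl, rfl, rfl⟩ | ⟨-, k, hk, rfl⟩⟩ := h
  · rw [Anchor.inv_inv] at s1
    simp only [ev_cons, ev_nil]
    exact val_cancel_of_side s1
  · simp only [ev_cons, ev_nil]
    simpa only [Anchor.inv_inv] using hk.val_middle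

theorem ev_eq_of_conv {g : GPrime} {s t : List (Anchor × GPrime)} (h : Conv g s t) :
    ev g s = ev g t := by
  induction h with
  | rel _ _ h =>
    obtain ⟨-, p, q, q', r, rfl, rfl, hr⟩ := up_iff.1 h
    simp only [ev_append, ev_eq_of_rule hr, hr.endOf_eq]
  | refl => rfl
  | symm _ _ _ ih => exact ih.symm
  | trans _ _ _ _ _ ih ih' => exact ih.trans ih'

theorem ev_upPath (g : GPrime) : ev GPrime.one g.upPath = g.val := by
  induction g using GPrime.induction with
  | one => rfl
  | gxx =>
    rw [GPrime.upPath_gxx, ev_cons, ev_nil, Anchor.one_val, GPrime.one_val_mul,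
      GPrime.one_val_mul]
  | tup g l la c ra r h _ ih _ =>
    rw [h.upPath_eq, ev_append, c.path_upPath.2, ih, ev_cons, ev_cons, ev_nil,
      c.val_mul_self_assoc, h.val_left]

theorem ev_downPath (g : GPrime) : ev g g.downPath = g.val := by
  induction g using GPrime.induction with
  | one => rfl
  | gxx =>
    rw [GPrime.downPath_gxx, ev_cons, ev_nil, Anchor.one_val, GPrime.mul_one_val,
      GPrime.mul_one_val]
  | tup g l la c ra r h _ ih _ =>
    rw [h.downPath_eq, ev_cons, ev_cons, ih, h.val_right]

theorem ev_upPath_downPath (g : GPrime) :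
    ev GPrime.one (g.upPath ++ g.downPath) = g.val := by
  rw [ev_append, g.path_upPath.2, ev_upPath, ev_downPath, g.val_mul_self]

theorem ev_anchor (a : Anchor) : ev GPrime.one a.toPath = a.val := by
  cases a with
  | one => rfl
  | x =>
    rw [Anchor.toPath, ev_cons, ev_cons, ev_nil, Anchor.one_val, GPrime.one_val_mul,
      GPrime.one_val_mul, GPrime.mul_one_val, GPrime.gxx_val, Anchor.x_val_mul]
  | x' =>
    rw [Anchor.toPath, ev_cons, ev_cons, ev_nil, Anchor.one_val, GPrime.one_val_mul,
      GPrime.mul_one_val, GPrime.mul_one_val, GPrime.gxx_val, ← mul_assoc, Anchor.x'_val_mul]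

theorem ev_wordPath (w : Word) : ev GPrime.one (wordPath w) = cls w := by
  have h : ∀ g : Alphabet, ev GPrime.one (wordPath (letter g)) = cls (letter g) := by
    intro g
    rw [wordPath_letter]
    rcases alphabet_cases g with ⟨a, rfl⟩ | ⟨k, rfl⟩
    · rw [letterPath_anchor]; exact ev_anchor a
    · rw [letterPath_gPrime]; exact ev_upPath_downPath k
  induction w using FreeSemigroup.recOnMul with
  | ih1 g => exact h g
  | ih2 g w h1 h2 =>
    rw [wordPath_mul, ev_append, (path_wordPath _).2, h2, h1, cls_mul]

namespace Mountain

theorem cls_toWord (u : Mountain) : cls u.word.toWord = ev GPrime.one u.word.steps := by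
  rw [ev, ← u.word_eq]

/-- The isomorphism from the monoid of mountains onto `F_1^1`. -/
noncomputable def equivF11 : Mountain ≃* F11 :=
  MulEquiv.ofBijective
    ({ toFun := fun u => cls u.word.toWord
       map_mul' := fun u v => by
        rw [cls_toWord, cls_toWord, cls_toWord, ← ev_eq_of_conv (conv_mul u v), ev_append,
          u.path.2] } : Mountain →ₙ* F11)
    -- Injectivity: a mountain is convertible to the expansion of its own word, equal classes have
    -- convertible expansions, and convertible mountains are equal. Surjectivity: reduce the
    -- expansion of a word to a mountain.
    ⟨fun u v h => eq_of_conv (u.conv_toWord.symm.trans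
      ((conv_of_cls_eq h).trans v.conv_toWord)), fun c => by
      induction c using Con.induction_on with
      | H w =>
        obtain ⟨u, hu⟩ := exists_conv (path_wordPath w)
        exact ⟨u, (cls_toWord u).trans ((ev_eq_of_conv hu).symm.trans (ev_wordPath w))⟩⟩

theorem equivF11_apply (u : Mountain) : equivF11 u = cls u.word.toWord := rfl

end Mountain

end Evaluation


/-! ### Uphills and downhills: decomposition, reversal, and persistence under uplifting. -/

section Hills

/-- All steps of the word go up. -/
abbrev AllUp (g : GPrime) (s : List (Anchor × GPrime)) : Prop :=
  Along (fun g₁ _ g₂ => IsEntry g₁ g₂) g s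

/-- All steps of the word go down. -/
abbrev AllDown (g : GPrime) (s : List (Anchor × GPrime)) : Prop :=
  Along (fun g₁ _ g₂ => IsEntry g₂ g₁) g s

theorem IsEntry.height {g h : GPrime} (hs : IsEntry g h) : h.height = g.height + 1 :=
  hs.elim fun _ h => Side.height h

theorem IsEntry.not_symm {g h : GPrime} (hs : IsEntry g h) : ¬ IsEntry h g := fun h' => by
  have := hs.height
  have := h'.height
  omega

theorem Anchored.entry {g h : GPrime} {a : Anchor} (hs : Anchored g a h) :
    IsEntry g h ∨ IsEntry h g :=
  hs.imp (fun h => ⟨_, h⟩) fun h => ⟨_, h⟩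

theorem AltWord.NoRiver.tail {g h : GPrime} {a : Anchor} {s : List (Anchor × GPrime)}
    (hn : (AltWord.mk g ((a, h) :: s)).NoRiver) : (AltWord.mk h s).NoRiver :=
  fun p a₁ g₁ b₁ h₁ s₁ hr => hn ((a, h) :: p) a₁ g₁ b₁ h₁ s₁ ⟨by
    have := hr.1
    simp only at this
    simp [this], hr.2⟩

/-- A step down followed by a step up encloses a river, so a riverless landscape never climbs again
after a descent. -/
theorem exists_hills : ∀ (s : List (Anchor × GPrime)) (g : GPrime), Along Anchored g s →
    (AltWord.mk g s).NoRiver → ∃ p d, s = p ++ d ∧ AllUp g p ∧ AllDown (endOf g p) d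
  | [], _, _, _ => ⟨[], [], rfl, trivial, trivial⟩
  | (a, h) :: s, g, hs, hn => by
    obtain ⟨p, d, rfl, hp, hd⟩ := exists_hills s h hs.2 hn.tail
    rcases hs.1.entry with he | he
    · exact ⟨(a, h) :: p, d, rfl, ⟨he, hp⟩, hd⟩
    · rcases p with _ | ⟨⟨b, k⟩, p⟩
      · exact ⟨[], (a, h) :: d, rfl, trivial, he, hd⟩
      · exact (hn [] a h b k (p ++ d) ⟨rfl, he.height, hp.1.height⟩).elim

theorem noRiver_append : ∀ (p : List (Anchor × GPrime)) (g : GPrime)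
    (d : List (Anchor × GPrime)), AllUp g p → AllDown (endOf g p) d →
    (AltWord.mk g (p ++ d)).NoRiver
  | [], g, d, _, hd => by
    rintro x a m b h s ⟨h1, -, h3⟩
    simp only [List.nil_append] at h1
    subst h1
    have := ((along_append _ _ _).1 hd).2.2.1.height
    simp only [GPrime.height] at this
    omega
  | (a₀, k) :: p, g, d, hp, hd => by
    rintro x a m b h s ⟨h1, h2, h3⟩
    rcases x with _ | ⟨z, x⟩
    · simp only [List.cons_append, List.nil_append, List.cons.injEq, Prod.mk.injEq, endOf]
        at h1 h2
      obtain ⟨⟨rfl, rfl⟩, -⟩ := h1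
      have := hp.1.height
      simp only [GPrime.height] at this
      omega
    · simp only [List.cons_append, List.cons.injEq] at h1
      obtain ⟨rfl, h1⟩ := h1
      exact noRiver_append p k d hp.2 hd x a m b h s ⟨h1, h2, h3⟩

theorem upSteps_append : ∀ (p : List (Anchor × GPrime)) (g : GPrime)
    (d : List (Anchor × GPrime)), AllUp g p → AllDown (endOf g p) d →
    AltWord.upSteps g (p ++ d) = p
  | [], _, [], _, _ => rfl
  | [], _, (_, _) :: _, _, hd => if_neg hd.1.not_symm
  | (a, h) :: p, g, d, hp, hd => by
    rw [List.cons_append, AltWord.upSteps, if_pos hp.1, upSteps_append p h d hp.2 hd]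

theorem downSuffix_append : ∀ (p : List (Anchor × GPrime)) (g : GPrime)
    (d : List (Anchor × GPrime)), AllUp g p → AllDown (endOf g p) d →
    AltWord.downSuffix g (p ++ d) = ⟨endOf g p, d⟩
  | [], _, [], _, _ => rfl
  | [], _, (_, _) :: _, _, hd => if_pos hd
  | (a, h) :: p, g, d, hp, hd => by
    rw [List.cons_append, AltWord.downSuffix, if_neg fun h => hp.1.not_symm h.1,
      downSuffix_append p h d hp.2 hd, endOf]

/-- A downhill can be climbed back. -/
theorem exists_reverse_down : ∀ (d : List (Anchor × GPrime)) (g h : GPrime), Path g d h →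
    AllDown g d → ∃ e, Path h e g ∧ Conv g (d ++ e) []
  | [], g, h, hp, _ => by
    obtain rfl : g = h := hp.2
    exact ⟨[], .nil _, .refl _ _⟩
  | (a, m) :: d, g, h, hp, hd => by
    obtain ⟨e, he, hc⟩ := exists_reverse_down d m h ⟨hp.1.2, hp.2⟩ hd.2
    have hs : Side m a.inv g := hp.1.1.side' hd.1.height
    refine ⟨e ++ [(a.inv, g)], he.append (.single (Or.inl hs)), ?_⟩
    have := (hc.append_right (Path.append ⟨hp.1.2, hp.2⟩ he)
      (.single (Or.inl hs : Anchored m a.inv g))).cons hp.1.1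
    rw [List.append_assoc] at this
    exact this.trans (conv_cancel_append' hs (.nil _))

/-- An uphill can be descended. -/
theorem exists_reverse_up : ∀ (p : List (Anchor × GPrime)) (g h : GPrime), Path g p h →
    AllUp g p → ∃ e, Path h e g ∧ Conv h (e ++ p) []
  | [], g, h, hp, _ => by
    obtain rfl : g = h := hp.2
    exact ⟨[], .nil _, .refl _ _⟩
  | (a, m) :: p, g, h, hp, hu => by
    have hp' : Path m p h := ⟨hp.1.2, hp.2⟩
    obtain ⟨e, he, hc⟩ := exists_reverse_up p m h hp' hu.2
    have hs : Side g a m := hp.1.1.side hu.1.height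
    have ha : Anchored m a.inv g := Or.inr (by rwa [Anchor.inv_inv])
    refine ⟨e ++ [(a.inv, g)], he.append (.single ha), ?_⟩
    rw [List.append_assoc]
    exact ((conv_cancel_append hs hp').append_left he).trans hc

theorem GPrime.allUp_upPath (g : GPrime) : AllUp GPrime.one g.upPath := by
  induction g using GPrime.induction with
  | one => trivial
  | gxx => rw [upPath_gxx]; exact ⟨⟨_, side_one_gxx⟩, trivial⟩
  | tup g l la c ra r h _ ih _ =>
    rw [h.upPath_eq]
    refine (along_append _ _ _).2 ⟨ih, ?_⟩
    rw [c.path_upPath.2]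
    exact ⟨⟨_, h.left⟩, ⟨_, h.sideLeft⟩, trivial⟩

theorem GPrime.allDown_downPath (g : GPrime) : AllDown g g.downPath := by
  induction g using GPrime.induction with
  | one => trivial
  | gxx => rw [downPath_gxx]; exact ⟨⟨_, side_one_gxx⟩, trivial⟩
  | tup g l la c ra r h _ ih _ =>
    rw [h.downPath_eq]
    exact ⟨⟨_, h.sideRight⟩, ⟨_, h.right⟩, ih⟩

/-- An uphill cannot contain the displayed step down, so it stops before it. -/
theorem prefix_of_step_down {g m : GPrime} {a : Anchor} {p x r : List (Anchor × GPrime)}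
    (hp : p <+: x ++ (a, m) :: r) (hu : AllUp g p) (he : IsEntry m (endOf g x)) : p <+: x := by
  have key : ¬ x ++ [(a, m)] <+: p := by
    rintro ⟨y, rfl⟩
    have h1 := ((along_append _ _ _).1 ((along_append _ _ _).1 hu).1).2
    exact he.not_symm h1.1
  have h2 : x ++ [(a, m)] <+: x ++ (a, m) :: r := ⟨r, by simp⟩
  rcases List.prefix_or_prefix_of_prefix hp h2 with h | h
  · rcases List.prefix_concat_iff.1 h with rfl | h
    · exact (key List.prefix_rfl).elim
    · exact h
  · exact (key h).elim

/-- The replaced factor opens with a step down, hence lies entirely beyond an uphill prefix. -/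
theorem Up.prefix_of_allUp {g : GPrime} {s t p : List (Anchor × GPrime)} (h : Up g s t)
    (hp : p <+: s) (hu : AllUp g p) : p <+: t := by
  obtain ⟨-, x, _, q', r, rfl, rfl, a, m, b, k, rfl, s1, -, -⟩ := up_iff.1 h
  exact (prefix_of_step_down hp hu ⟨_, s1⟩).trans (List.prefix_append _ _)

theorem suffix_of_step_up {g h : GPrime} {b : Anchor} {x d p r : List (Anchor × GPrime)}
    (e : x ++ d = p ++ (b, h) :: r) (hd : AllDown (endOf g x) d) (he : IsEntry (endOf g p) h) :
    ∃ y, x = p ++ (b, h) :: y ∧ r = y ++ d := by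
  rcases List.append_eq_append_iff.1 e with ⟨c, rfl, rfl⟩ | ⟨c, rfl, h2⟩
  · rw [endOf_append] at he
    exact (he.not_symm ((along_append _ _ _).1 hd).2.1).elim
  · rcases c with _ | ⟨z, y⟩
    · obtain rfl : _ = d := h2
      rw [List.append_nil] at hd
      exact (he.not_symm hd.1).elim
    · obtain ⟨rfl, rfl⟩ := List.cons.inj h2
      exact ⟨y, rfl, rfl⟩

/-- Dually, the factor closes with a step up, so a downhill suffix begins after it; the starting
letter of the suffix has to be tracked, because a list of steps does not contain it. -/
theorem Up.suffix_of_allDown {g k : GPrime} {s t d : List (Anchor × GPrime)} (hu : Up g s t)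
    (hs : ∃ x, s = x ++ d ∧ endOf g x = k) (hd : AllDown k d) :
    ∃ x, t = x ++ d ∧ endOf g x = k := by
  obtain ⟨-, p, _, q', r, rfl, rfl, hr⟩ := up_iff.1 hu
  obtain ⟨x, hx, rfl⟩ := hs
  obtain ⟨a, m, b, h, rfl, -, s2, -⟩ := id hr
  have e : x ++ d = (p ++ [(a, m)]) ++ (b, h) :: r := by rw [← hx]; simp
  obtain ⟨y, rfl, rfl⟩ := suffix_of_step_up (g := g) e hd
    (by rw [endOf_append]; exact ⟨_, s2⟩)
  refine ⟨p ++ (q' ++ y), by simp, ?_⟩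
  rw [show p ++ [(a, m)] ++ (b, h) :: y = p ++ ([(a, m), (b, h)] ++ y) by simp]
  simp only [endOf_append, hr.endOf_eq]

end Hills

namespace Mountain

/-! ### The two hills of a mountain. -/

section Hills

/-- The steps of the left hill. -/
noncomputable def ups (u : Mountain) : List (Anchor × GPrime) :=
  AltWord.upSteps GPrime.one u.word.steps

/-- The steps of the right hill. -/
noncomputable def downs (u : Mountain) : List (Anchor × GPrime) := u.rightHill.steps

theorem hills_spec {u : Mountain} {p d : List (Anchor × GPrime)} (h : u.word.steps = p ++ d)
    (hp : AllUp GPrime.one p) (hd : AllDown (endOf GPrime.one p) d) :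
    u.leftHill = ⟨GPrime.one, p⟩ ∧ u.rightHill = ⟨endOf GPrime.one p, d⟩ ∧
      u.peak = endOf GPrime.one p := by
  have h1 : u.leftHill = ⟨GPrime.one, p⟩ := by
    rw [leftHill, u.head_eq, h, upSteps_append p _ d hp hd]
  refine ⟨h1, ?_, ?_⟩
  · rw [rightHill, u.head_eq, h, downSuffix_append p _ d hp hd]
  · rw [peak, h1]; rfl

theorem hills (u : Mountain) : u.word.steps = u.ups ++ u.downs ∧ AllUp GPrime.one u.ups ∧
    AllDown u.peak u.downs ∧ u.leftHill = ⟨GPrime.one, u.ups⟩ ∧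
    u.rightHill = ⟨u.peak, u.downs⟩ ∧ u.peak = endOf GPrime.one u.ups := by
  obtain ⟨p, d, h, hp, hd⟩ := exists_hills _ _ u.path.1 u.noRiver'
  obtain ⟨h1, h2, h3⟩ := hills_spec h hp hd
  have e1 : u.ups = p := by rw [ups, h, upSteps_append p _ d hp hd]
  have e2 : u.downs = d := by rw [downs, h2]
  rw [e1, e2, h3]
  exact ⟨h, hp, hd, h1, h2, rfl⟩

theorem steps_eq (u : Mountain) : u.word.steps = u.ups ++ u.downs := u.hills.1

theorem allUp_ups (u : Mountain) : AllUp GPrime.one u.ups := u.hills.2.1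

theorem allDown_downs (u : Mountain) : AllDown u.peak u.downs := u.hills.2.2.1

theorem leftHill_eq (u : Mountain) : u.leftHill = ⟨GPrime.one, u.ups⟩ := u.hills.2.2.2.1

theorem rightHill_eq (u : Mountain) : u.rightHill = ⟨u.peak, u.downs⟩ := u.hills.2.2.2.2.1

theorem endOf_ups (u : Mountain) : endOf GPrime.one u.ups = u.peak := u.hills.2.2.2.2.2.symm

theorem path_ups (u : Mountain) : Path GPrime.one u.ups u.peak := by
  have h := u.path.1
  rw [u.steps_eq, along_append] at h
  exact ⟨h.1, u.endOf_ups⟩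

theorem path_downs (u : Mountain) : Path u.peak u.downs GPrime.one := by
  have h := u.path
  rw [u.steps_eq, Path, along_append, endOf_append, u.endOf_ups] at h
  exact ⟨h.1.2, h.2⟩

theorem exists_of_hills {g : GPrime} {p d : List (Anchor × GPrime)} (hp : Path GPrime.one p g)
    (hd : Path g d GPrime.one) (hu : AllUp GPrime.one p) (hd' : AllDown g d) :
    ∃ u : Mountain, u.word.steps = p ++ d ∧ u.leftHill = ⟨GPrime.one, p⟩ ∧
      u.rightHill = ⟨g, d⟩ ∧ u.peak = g := by
  have hg := hp.2
  subst hg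
  exact ⟨ofPath (p ++ d) (hp.append hd) (noRiver_append _ _ _ hu hd'), rfl,
    hills_spec rfl hu hd'⟩

end Hills

end Mountain

/-! ### Prefixes and suffixes of words in terms of steps. -/

section Letters

theorem Anchor.toAlphabet_injective : Function.Injective Anchor.toAlphabet := fun _ _ h =>
  Letter.anchor.inj (congrArg (fun z : Alphabet => z.1) h)

theorem GPrime.toAlphabet_injective : Function.Injective GPrime.toAlphabet := fun _ _ e =>
  Subtype.ext (congrArg (fun z : Alphabet => z.1) e)

theorem tailLetters_cons (a : Anchor) (h : GPrime) (s : List (Anchor × GPrime)) :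
    AltWord.tailLetters ((a, h) :: s) =
      a.toAlphabet :: h.toAlphabet :: AltWord.tailLetters s := rfl

theorem tailLetters_prefix_iff : ∀ s t : List (Anchor × GPrime),
    AltWord.tailLetters s <+: AltWord.tailLetters t ↔ s <+: t
  | [], t => by simp [AltWord.tailLetters]
  | (a, h) :: s, [] => by simp [AltWord.tailLetters]
  | (a, h) :: s, (b, k) :: t => by
    rw [tailLetters_cons, tailLetters_cons, List.cons_prefix_cons, List.cons_prefix_cons,
      List.cons_prefix_cons, tailLetters_prefix_iff s t, Anchor.toAlphabet_injective.eq_iff,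
      GPrime.toAlphabet_injective.eq_iff, Prod.mk.injEq, and_assoc]

theorem letters_prefix_iff {g : GPrime} {s t : List (Anchor × GPrime)} :
    (AltWord.mk g s).letters <+: (AltWord.mk g t).letters ↔ s <+: t := by
  simp only [AltWord.letters, List.cons_prefix_cons, true_and, tailLetters_prefix_iff]

theorem length_tailLetters : ∀ s : List (Anchor × GPrime),
    (AltWord.tailLetters s).length = 2 * s.length
  | [] => rfl
  | (_, _) :: s => by
    rw [tailLetters_cons, List.length_cons, List.length_cons, length_tailLetters s,
      List.length_cons]
    ring

theorem tailLetters_injective : Function.Injective AltWord.tailLetters := fun s t h => by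
  have h1 := (tailLetters_prefix_iff s t).1 (by rw [h])
  have h2 := congrArg List.length h
  rw [length_tailLetters, length_tailLetters] at h2
  exact h1.eq_of_length (by omega)

theorem letters_suffix_iff : ∀ (t s : List (Anchor × GPrime)) (g k : GPrime),
    (AltWord.mk g s).letters <:+ (AltWord.mk k t).letters ↔
      ∃ y, t = y ++ s ∧ endOf k y = g
  | [], s, g, k => by
    simp only [AltWord.letters]
    constructor
    · intro h
      have h1 := h.length_le
      simp only [List.length_cons, length_tailLetters, List.length_nil] at h1
      obtain rfl : s = [] := List.eq_nil_of_length_eq_zero (by omega)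
      refine ⟨[], rfl, ?_⟩
      have := h.eq_of_length rfl
      exact (GPrime.toAlphabet_injective (List.cons.inj this).1).symm
    · rintro ⟨y, hy, rfl⟩
      obtain ⟨rfl, rfl⟩ := List.append_eq_nil_iff.1 hy.symm
      exact List.suffix_rfl
  | (a, h) :: t, s, g, k => by
    have ih := letters_suffix_iff t s g h
    simp only [AltWord.letters] at ih ⊢
    rw [tailLetters_cons, List.suffix_cons_iff, List.suffix_cons_iff, ih, List.cons.injEq,
      ← tailLetters_cons, tailLetters_injective.eq_iff, GPrime.toAlphabet_injective.eq_iff]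
    constructor
    · rintro (⟨rfl, rfl⟩ | h1 | ⟨y, rfl, rfl⟩)
      · exact ⟨[], rfl, rfl⟩
      -- The anchor `1` and the letter `1` of `G'` are the same letter of the alphabet, so a suffix
      -- starting at an anchor is excluded by parity of length and not by its first letter.
      · have := congrArg List.length h1
        simp only [List.length_cons, length_tailLetters] at this
        omega
      · exact ⟨(a, h) :: y, rfl, rfl⟩
    · rintro ⟨_ | ⟨z, y⟩, h1, rfl⟩
      · exact Or.inl ⟨rfl, h1.symm⟩
      · obtain ⟨rfl, rfl⟩ := List.cons.inj h1
        exact Or.inr (Or.inr ⟨y, rfl, rfl⟩)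

end Letters

/-! ### The ground as the set of letters reachable by descent. -/

section Ground

namespace Letter

theorem self_mem_ground : ∀ g : Letter, g ∈ ground g
  | .anchor _ => rfl
  | .tup _ _ _ _ _ => Or.inl (Or.inr rfl)

theorem mem_ground_tup {g l c r : Letter} {la ra : Anchor} :
    g ∈ ground (tup l la c ra r) ↔ g ∈ ground l ∨ g = tup l la c ra r ∨ g ∈ ground r := by
  rw [ground, Set.mem_union, Set.mem_union, Set.mem_singleton_iff, or_assoc]

theorem ground_trans {g h : Letter} (h1 : g ∈ ground h) : ∀ {k : Letter}, h ∈ ground k →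
    g ∈ ground k
  | .anchor a, h2 => by
    obtain rfl : h = .anchor a := h2
    exact h1
  | .tup l la c ra r, h2 => by
    rcases mem_ground_tup.1 h2 with h2 | rfl | h2
    · exact mem_ground_tup.2 (Or.inl (ground_trans h1 h2))
    · exact h1
    · exact mem_ground_tup.2 (Or.inr (Or.inr (ground_trans h1 h2)))

theorem mem_ground_of_isSide {g h : Letter} {a : Anchor} (hs : IsSide g a h) : g ∈ ground h := by
  cases h with
  | anchor => exact hs.elim
  | tup l la c ra r =>
    rcases hs with ⟨rfl, -⟩ | ⟨rfl, -⟩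
    · exact mem_ground_tup.2 (Or.inl (self_mem_ground _))
    · exact mem_ground_tup.2 (Or.inr (Or.inr (self_mem_ground _)))

end Letter

theorem IsEntry.mem_ground {g h : GPrime} (hs : IsEntry g h) : g.1 ∈ h.1.ground :=
  hs.elim fun _ h => Letter.mem_ground_of_isSide h

theorem AllUp.mem_ground : ∀ (s : List (Anchor × GPrime)) (g : GPrime), AllUp g s →
    g.1 ∈ (endOf g s).1.ground
  | [], g, _ => Letter.self_mem_ground g.1
  | (_, h) :: s, _, hs => Letter.ground_trans hs.1.mem_ground (AllUp.mem_ground s h hs.2)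

theorem AllDown.mem_ground : ∀ (s : List (Anchor × GPrime)) (g : GPrime), AllDown g s →
    (endOf g s).1 ∈ g.1.ground
  | [], g, _ => Letter.self_mem_ground g.1
  | (_, h) :: s, _, hs => Letter.ground_trans (AllDown.mem_ground s h hs.2) hs.1.mem_ground

theorem exists_down_of_mem_ground (g : GPrime) : ∀ (k : Letter) (hk : k ∈ Letter.G'),
    g.1 ∈ k.ground → ∃ d, Path ⟨k, hk⟩ d g ∧ AllDown ⟨k, hk⟩ d
  | .anchor a, hk, h => by
    obtain rfl : g = ⟨.anchor a, hk⟩ := Subtype.ext h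
    exact ⟨[], .nil _, trivial⟩
  | .tup l la c ra r, hk, h => by
    rcases Letter.mem_ground_tup.1 h with h | h | h
    · obtain ⟨d, h1, h2⟩ := exists_down_of_mem_ground g l (Letter.left_mem hk) h
      have hs : Side ⟨l, Letter.left_mem hk⟩ la ⟨_, hk⟩ := Or.inl ⟨rfl, rfl⟩
      exact ⟨(la.inv, ⟨l, Letter.left_mem hk⟩) :: d,
        .cons (Or.inr (by rwa [Anchor.inv_inv])) h1, ⟨_, hs⟩, h2⟩
    · obtain rfl : g = ⟨_, hk⟩ := Subtype.ext h
      exact ⟨[], .nil _, trivial⟩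
    · obtain ⟨d, h1, h2⟩ := exists_down_of_mem_ground g r (Letter.right_mem hk) h
      have hs : Side ⟨r, Letter.right_mem hk⟩ ra ⟨_, hk⟩ := Or.inr ⟨rfl, rfl⟩
      exact ⟨(ra.inv, ⟨r, Letter.right_mem hk⟩) :: d,
        .cons (Or.inr (by rwa [Anchor.inv_inv])) h1, ⟨_, hs⟩, h2⟩

theorem eq_or_height_lt : ∀ (d : List (Anchor × GPrime)) (g : GPrime), AllDown g d →
    endOf g d = g ∨ (endOf g d).height < g.height
  | [], _, _ => Or.inl rfl
  | (_, h) :: d, _, hd => by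
    right
    have h1 := hd.1.height
    rcases eq_or_height_lt d h hd.2 with h2 | h2
    · rw [endOf, h2]; omega
    · rw [endOf]; omega

/-- A nonempty descent strictly lowers the height, so two letters cannot each lie properly below the
other. -/
theorem ground_antisymm {g h : GPrime} (h1 : g.1 ∈ h.1.ground) (h2 : h.1 ∈ g.1.ground) :
    g = h := by
  obtain ⟨d, p, hd⟩ := exists_down_of_mem_ground g h.1 h.2 h1
  obtain ⟨e, q, he⟩ := exists_down_of_mem_ground h g.1 g.2 h2
  have h3 := eq_or_height_lt d _ hd
  have h4 := eq_or_height_lt e _ he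
  rw [p.2] at h3
  rw [q.2] at h4
  rcases h3 with h3 | h3
  · exact h3
  · rcases h4 with h4 | h4
    · exact h4.symm
    · simp only [GPrime.height] at h3 h4
      omega

/-- The landscape passes through `k`. -/
def Visits (g : GPrime) (s : List (Anchor × GPrime)) (k : GPrime) : Prop :=
  ∃ p r, s = p ++ r ∧ endOf g p = k

/-- The only visited letter that an uplifting can lose is the river, and it is a side of the letter
before it, which is still visited. -/
theorem Up.visits {g k : GPrime} {s t : List (Anchor × GPrime)} (hu : Up g s t)
    (hk : Visits g s k) : ∃ k', Visits g t k' ∧ k.1 ∈ k'.1.ground := by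
  obtain ⟨-, x, _, q', y, rfl, rfl, hr⟩ := up_iff.1 hu
  obtain ⟨a, m, b, h, rfl, s1, -, -⟩ := id hr
  obtain ⟨p, r, he, rfl⟩ := hk
  rcases List.append_eq_append_iff.1 he with ⟨c, rfl, hc⟩ | ⟨c, rfl, rfl⟩
  · rcases c with _ | ⟨z, _ | ⟨w, c⟩⟩
    · exact ⟨_, ⟨x, q' ++ y, rfl, rfl⟩, by
        rw [List.append_nil]; exact Letter.self_mem_ground _⟩
    · refine ⟨endOf g x, ⟨x, q' ++ y, rfl, rfl⟩, ?_⟩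
      obtain ⟨rfl, -⟩ := List.cons.inj hc
      rw [endOf_append]
      exact Letter.mem_ground_of_isSide s1
    · obtain ⟨rfl, hc'⟩ := List.cons.inj hc
      obtain ⟨rfl, rfl⟩ := List.cons.inj hc'
      refine ⟨_, ⟨x ++ (q' ++ c), r, by simp, rfl⟩, ?_⟩
      rw [show x ++ (a, m) :: (b, h) :: c = x ++ ([(a, m), (b, h)] ++ c) from rfl]
      simp only [endOf_append, hr.endOf_eq]
      exact Letter.self_mem_ground _
  · exact ⟨_, ⟨p, c ++ (q' ++ y), by simp, rfl⟩, Letter.self_mem_ground _⟩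

theorem Mountain.mem_ground_of_visits {u : Mountain} {k : GPrime}
    (h : Visits GPrime.one u.word.steps k) : k.1 ∈ u.peak.1.ground := by
  obtain ⟨p, r, h, rfl⟩ := h
  rw [u.steps_eq] at h
  have h1 := u.allUp_ups
  have h2 := u.allDown_downs
  have h3 := u.endOf_ups
  rcases List.append_eq_append_iff.1 h with ⟨c, rfl, hc⟩ | ⟨c, hc, rfl⟩
  · rw [hc] at h2
    rw [endOf_append, h3]
    exact AllDown.mem_ground _ _ ((along_append _ _ _).1 h2).1
  · rw [hc] at h1
    rw [hc, endOf_append] at h3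
    rw [← h3]
    exact AllUp.mem_ground _ _ ((along_append _ _ _).1 h1).2

end Ground


/-! ### Green's preorders in semigroups and monoids, and their transport along isomorphisms. -/

section Green

theorem leR_iff {S : Type*} [Semigroup S] {s t : S} : LeR s t ↔ s = t ∨ ∃ w, s = t * w := by
  constructor
  · intro h
    obtain ⟨p, hp⟩ := h (show s ∈ _ from ⟨1, (mul_one _).symm⟩)
    induction p using WithOne.recOneCoe with
    | one => exact Or.inl (WithOne.coe_inj.1 (by rwa [mul_one] at hp))
    | coe p => exact Or.inr ⟨p, WithOne.coe_inj.1 (by rwa [WithOne.coe_mul])⟩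
  · rintro (rfl | ⟨w, rfl⟩)
    · exact fun _ h => h
    · rintro y ⟨p, hp⟩
      exact ⟨w * p, by rw [hp, WithOne.coe_mul, mul_assoc]⟩

theorem leL_iff {S : Type*} [Semigroup S] {s t : S} : LeL s t ↔ s = t ∨ ∃ w, s = w * t := by
  constructor
  · intro h
    obtain ⟨p, hp⟩ := h (show s ∈ _ from ⟨1, (one_mul _).symm⟩)
    induction p using WithOne.recOneCoe with
    | one => exact Or.inl (WithOne.coe_inj.1 (by rwa [one_mul] at hp))
    | coe p => exact Or.inr ⟨p, WithOne.coe_inj.1 (by rwa [WithOne.coe_mul])⟩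
  · rintro (rfl | ⟨w, rfl⟩)
    · exact fun _ h => h
    · rintro y ⟨p, hp⟩
      exact ⟨p * w, by rw [hp, WithOne.coe_mul, mul_assoc]⟩

theorem leR_iff_of_monoid {S : Type*} [Monoid S] {s t : S} : LeR s t ↔ ∃ w, s = t * w :=
  leR_iff.trans ⟨fun h => h.elim (fun h => ⟨1, by rw [h, mul_one]⟩) id, Or.inr⟩

theorem leL_iff_of_monoid {S : Type*} [Monoid S] {s t : S} : LeL s t ↔ ∃ w, s = w * t :=
  leL_iff.trans ⟨fun h => h.elim (fun h => ⟨1, by rw [h, one_mul]⟩) id, Or.inr⟩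

theorem leJ_iff_of_monoid {S : Type*} [Monoid S] {s t : S} :
    LeJ s t ↔ ∃ v w, s = v * t * w := by
  constructor
  · intro h
    obtain ⟨p, q, hp⟩ := h (show s ∈ _ from ⟨1, 1, by rw [one_mul, mul_one]⟩)
    induction p using WithOne.recOneCoe with
    | one =>
      rw [one_mul] at hp
      induction q using WithOne.recOneCoe with
      | one => exact ⟨1, 1, WithOne.coe_inj.1 (by rwa [one_mul, mul_one, ← mul_one (t : WithOne S)])⟩
      | coe q => exact ⟨1, q, WithOne.coe_inj.1 (by rwa [one_mul, WithOne.coe_mul])⟩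
    | coe p =>
      induction q using WithOne.recOneCoe with
      | one => exact ⟨p, 1, WithOne.coe_inj.1 (by rwa [mul_one, WithOne.coe_mul,
          ← mul_one ((p : WithOne S) * t)])⟩
      | coe q => exact ⟨p, q, WithOne.coe_inj.1 (by rwa [WithOne.coe_mul, WithOne.coe_mul])⟩
  · rintro ⟨v, w, rfl⟩ y ⟨p, q, hp⟩
    exact ⟨p * v, w * q, by rw [hp, WithOne.coe_mul, WithOne.coe_mul]; simp only [mul_assoc]⟩

theorem leR_map_iff {S T : Type*} [Semigroup S] [Semigroup T] (e : S ≃* T) {s t : S} :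
    LeR (e s) (e t) ↔ LeR s t := by
  rw [leR_iff, leR_iff, e.injective.eq_iff, e.surjective.exists]
  simp only [← map_mul, e.injective.eq_iff]

theorem leL_map_iff {S T : Type*} [Semigroup S] [Semigroup T] (e : S ≃* T) {s t : S} :
    LeL (e s) (e t) ↔ LeL s t := by
  rw [leL_iff, leL_iff, e.injective.eq_iff, e.surjective.exists]
  simp only [← map_mul, e.injective.eq_iff]

theorem GreenD.map {S T : Type*} [Semigroup S] [Semigroup T] (e : S ≃* T) {s t : S}
    (h : GreenD s t) : GreenD (e s) (e t) := by
  induction h with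
  | rel _ _ h =>
    refine .rel _ _ (h.imp ?_ ?_)
    · exact fun h => ⟨(leL_map_iff e).2 h.1, (leL_map_iff e).2 h.2⟩
    · exact fun h => ⟨(leR_map_iff e).2 h.1, (leR_map_iff e).2 h.2⟩
  | refl => exact .refl _
  | symm _ _ _ ih => exact .symm _ _ ih
  | trans _ _ _ _ _ ih ih' => exact .trans _ _ _ ih ih'

theorem greenD_map_iff {S T : Type*} [Semigroup S] [Semigroup T] (e : S ≃* T) {s t : S} :
    GreenD (e s) (e t) ↔ GreenD s t :=
  ⟨fun h => by simpa using h.map e.symm, fun h => h.map e⟩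

end Green

namespace Mountain

/-! ### Green's relations on mountains. -/

section Green

/-- The left hill of `v` is an uphill prefix of `v * w`, so it survives the reduction. Conversely,
the multiplier climbs back up the right hill of `v` and continues along `u`. -/
theorem leR_iff_ups {u v : Mountain} : LeR u v ↔ v.ups <+: u.ups := by
  rw [leR_iff_of_monoid]
  constructor
  · rintro ⟨w, hw⟩
    have h := (conv_mul_iff.2 hw).reflTransGen u.noRiver'
    have h1 : v.ups <+: v.word.steps ++ w.word.steps := by
      rw [v.steps_eq, List.append_assoc]; exact List.prefix_append _ _
    have h2 : v.ups <+: u.word.steps := by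
      generalize v.word.steps ++ w.word.steps = s at h h1
      generalize u.word.steps = t at h ⊢
      induction h with
      | refl => exact h1
      | tail _ h ih => exact h.prefix_of_allUp ih v.allUp_ups
    rw [u.steps_eq] at h2
    have h3 := u.allDown_downs
    -- The prefix found so far is one of all of `u`; a first step down after the peak confines it to
    -- the left hill.
    rcases hd : u.downs with _ | ⟨⟨a, m⟩, r⟩
    · rwa [hd, List.append_nil] at h2
    · rw [hd] at h2 h3
      exact prefix_of_step_down h2 v.allUp_ups (by rw [u.endOf_ups]; exact h3.1)
  · rintro ⟨y, hy⟩
    obtain ⟨e, he, hc⟩ := exists_reverse_down _ _ _ v.path_downs v.allDown_downs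
    have hy' : Path v.peak y u.peak := by
      have h := u.path_ups
      rw [← hy, Path, along_append, endOf_append, v.endOf_ups] at h
      exact ⟨h.1.2, h.2⟩
    obtain ⟨w, hw⟩ := exists_conv (he.append (hy'.append u.path_downs))
    refine ⟨w, conv_mul_iff.1 ((hw.symm.append_left v.path).trans ?_)⟩
    rw [v.steps_eq, u.steps_eq, ← hy, List.append_assoc, List.append_assoc,
      ← List.append_assoc v.downs]
    exact (hc.append_right (v.path_downs.append he) (hy'.append u.path_downs)).append_left
      v.path_ups

theorem leL_iff_downs {u v : Mountain} :
    LeL u v ↔ ∃ y, u.downs = y ++ v.downs ∧ endOf u.peak y = v.peak := by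
  rw [leL_iff_of_monoid]
  constructor
  · rintro ⟨w, hw⟩
    have h := (conv_mul_iff.2 hw).reflTransGen u.noRiver'
    have h1 : ∃ x, w.word.steps ++ v.word.steps = x ++ v.downs ∧
        endOf GPrime.one x = v.peak := by
      refine ⟨w.word.steps ++ v.ups, by rw [v.steps_eq, List.append_assoc], ?_⟩
      rw [endOf_append, w.path.2, v.endOf_ups]
    have h2 : ∃ x, u.word.steps = x ++ v.downs ∧ endOf GPrime.one x = v.peak := by
      generalize w.word.steps ++ v.word.steps = s at h h1
      generalize u.word.steps = t at h ⊢
      induction h with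
      | refl => exact h1
      | tail _ h ih => exact h.suffix_of_allDown ih v.allDown_downs
    obtain ⟨x, hx, hx'⟩ := h2
    rw [u.steps_eq] at hx
    have h3 := u.allUp_ups
    have h4 := u.endOf_ups
    rcases List.eq_nil_or_concat' u.ups with hu | ⟨p, ⟨b, k⟩, hu⟩
    · rw [hu] at hx h4
      exact ⟨x, hx, by rw [← h4]; exact hx'⟩
    · rw [hu] at hx h3 h4
      rw [List.append_assoc] at hx
      obtain ⟨y, rfl, hy⟩ := suffix_of_step_up (g := GPrime.one) hx.symm
        (by rw [hx']; exact v.allDown_downs) ((along_append _ _ _).1 h3).2.1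
      refine ⟨y, hy, ?_⟩
      rw [← h4, ← hx', ← endOf_append]
      simp
  · rintro ⟨y, hy, hy'⟩
    obtain ⟨e, he, hc⟩ := exists_reverse_up _ _ _ v.path_ups v.allUp_ups
    have hp : Path u.peak y v.peak := by
      have h := u.path_downs.1
      rw [hy, along_append] at h
      exact ⟨h.1, hy'⟩
    obtain ⟨w, hw⟩ := exists_conv ((u.path_ups.append hp).append he)
    refine ⟨w, conv_mul_iff.1 ((hw.symm.append_right w.path v.path).trans ?_)⟩
    rw [v.steps_eq, u.steps_eq, hy, List.append_assoc, ← List.append_assoc e,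
      ← List.append_assoc u.ups]
    exact (hc.append_right (he.append v.path_ups) v.path_downs).append_left
      (u.path_ups.append hp)

/-- The peak of `v` is visited in any product containing `v`, so after reduction it lies in the
ground of a visited letter, hence in that of the peak of `u`. Conversely, `u` can be interrupted at
its peak by a descent to the peak of `v` and the return. -/
theorem leJ_iff_ground {u v : Mountain} : LeJ u v ↔ v.peak.1 ∈ u.peak.1.ground := by
  rw [leJ_iff_of_monoid]
  constructor
  · rintro ⟨p, q, hu⟩
    have h1 : Conv GPrime.one (p.word.steps ++ v.word.steps ++ q.word.steps) u.word.steps :=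
      ((conv_mul p v).append_right (p.path.append v.path) q.path).trans (conv_mul_iff.2 hu)
    have h := h1.reflTransGen u.noRiver'
    have h2 : ∃ k', Visits GPrime.one (p.word.steps ++ v.word.steps ++ q.word.steps) k' ∧
        v.peak.1 ∈ k'.1.ground := by
      refine ⟨v.peak, ⟨p.word.steps ++ v.ups, v.downs ++ q.word.steps, ?_, ?_⟩,
        Letter.self_mem_ground _⟩
      · rw [v.steps_eq]; simp
      · rw [endOf_append, p.path.2, v.endOf_ups]
    have h3 : ∃ k', Visits GPrime.one u.word.steps k' ∧ v.peak.1 ∈ k'.1.ground := by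
      generalize p.word.steps ++ v.word.steps ++ q.word.steps = s at h h2
      generalize u.word.steps = t at h ⊢
      induction h with
      | refl => exact h2
      | tail _ h ih =>
        obtain ⟨k, hk, hk'⟩ := ih
        obtain ⟨l, hl, hl'⟩ := h.visits hk
        exact ⟨l, hl, Letter.ground_trans hk' hl'⟩
    obtain ⟨k, hk, hk'⟩ := h3
    exact Letter.ground_trans hk' (mem_ground_of_visits hk)
  · intro h
    obtain ⟨d, hd, hd'⟩ := exists_down_of_mem_ground v.peak u.peak.1 u.peak.2 h
    obtain ⟨d', hr, hrc⟩ := exists_reverse_down _ _ _ hd hd'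
    obtain ⟨e, he, hec⟩ := exists_reverse_up _ _ _ v.path_ups v.allUp_ups
    obtain ⟨f, hf, hfc⟩ := exists_reverse_down _ _ _ v.path_downs v.allDown_downs
    -- The left multiplier climbs `u`, descends by `d` to the peak of `v` and leaves by the reversed
    -- left hill of `v`; the right one enters by the reversed right hill, climbs back by `d'` and
    -- descends `u`. In the product the hills of `v` cancel first, then `d` against `d'`.
    have pe := u.path_ups.append (hd.append he)
    have pf := hf.append (hr.append u.path_downs)
    obtain ⟨p, hp⟩ := exists_conv pe
    obtain ⟨q, hq⟩ := exists_conv pf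
    refine ⟨p, q, conv_mul_iff.1 ?_⟩
    have h1 : Conv GPrime.one ((p * v).word.steps ++ q.word.steps)
        (p.word.steps ++ v.word.steps ++ q.word.steps) :=
      (conv_mul p v).symm.append_right (p * v).path q.path
    have h2 : Conv GPrime.one (p.word.steps ++ v.word.steps ++ q.word.steps)
        (u.ups ++ (d ++ e) ++ v.word.steps ++ (f ++ (d' ++ u.downs))) :=
      (hp.symm.append_right p.path v.path).append hq.symm (p.path.append v.path) q.path
    have h3 : u.ups ++ (d ++ e) ++ v.word.steps ++ (f ++ (d' ++ u.downs)) = (u.ups ++ d) ++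
        ((e ++ v.ups) ++ ((v.downs ++ f) ++ (d' ++ u.downs))) := by
      rw [v.steps_eq]; simp only [List.append_assoc]
    rw [h3] at h2
    have h4 := ((hec.append (hfc.append_right (v.path_downs.append hf) (hr.append u.path_downs))
      (he.append v.path_ups) ((v.path_downs.append hf).append
        (hr.append u.path_downs))).append_left (u.path_ups.append hd))
    have h5 := (hrc.append_right (hd.append hr) u.path_downs).append_left u.path_ups
    rw [u.steps_eq]
    simp only [List.nil_append, List.append_assoc] at h1 h2 h4 h5 ⊢
    exact h1.trans (h2.trans (h4.trans h5))

theorem leR_iff_leftHill {u v : Mountain} :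
    LeR u v ↔ v.leftHill.letters <+: u.leftHill.letters := by
  rw [leR_iff_ups, u.leftHill_eq, v.leftHill_eq, letters_prefix_iff]

theorem leL_iff_rightHill {u v : Mountain} :
    LeL u v ↔ v.rightHill.letters <:+ u.rightHill.letters := by
  rw [leL_iff_downs, u.rightHill_eq, v.rightHill_eq, letters_suffix_iff]

theorem greenR_iff {u v : Mountain} : GreenR u v ↔ u.leftHill = v.leftHill := by
  rw [GreenR, leR_iff_ups, leR_iff_ups, u.leftHill_eq, v.leftHill_eq, AltWord.mk.injEq]
  constructor
  · rintro ⟨h1, h2⟩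
    exact ⟨rfl, h2.eq_of_length_le h1.length_le⟩
  · rintro ⟨-, h⟩
    rw [h]
    exact ⟨List.prefix_rfl, List.prefix_rfl⟩

theorem greenL_iff {u v : Mountain} : GreenL u v ↔ u.rightHill = v.rightHill := by
  rw [GreenL, leL_iff_downs, leL_iff_downs, u.rightHill_eq, v.rightHill_eq, AltWord.mk.injEq]
  constructor
  · rintro ⟨⟨y, h1, h2⟩, ⟨z, h3, -⟩⟩
    have h4 := congrArg List.length h1
    have h5 := congrArg List.length h3
    rw [List.length_append] at h4 h5
    obtain rfl : y = [] := List.eq_nil_of_length_eq_zero (by omega)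
    exact ⟨h2, h1⟩
  · rintro ⟨h1, h2⟩
    exact ⟨⟨[], h2, h1⟩, ⟨[], h2.symm, h1.symm⟩⟩

theorem greenJ_iff {u v : Mountain} : GreenJ u v ↔ u.peak = v.peak := by
  rw [GreenJ, leJ_iff_ground, leJ_iff_ground]
  constructor
  · rintro ⟨h1, h2⟩
    exact ground_antisymm h2 h1
  · intro h
    rw [h]
    exact ⟨Letter.self_mem_ground _, Letter.self_mem_ground _⟩

theorem greenH_iff {u v : Mountain} : GreenH u v ↔ u = v := by
  rw [GreenH, greenL_iff, greenR_iff]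
  constructor
  · rintro ⟨h1, h2⟩
    rw [u.leftHill_eq, v.leftHill_eq, AltWord.mk.injEq] at h2
    rw [u.rightHill_eq, v.rightHill_eq, AltWord.mk.injEq] at h1
    refine Mountain.ext ?_
    rw [u.word_eq, v.word_eq, u.steps_eq, v.steps_eq, h1.2, h2.2]
  · rintro rfl
    exact ⟨rfl, rfl⟩

theorem greenD_iff_peak {u v : Mountain} : GreenD u v ↔ u.peak = v.peak := by
  constructor
  · intro h
    induction h with
    | rel u v h =>
      rcases h with h | h
      · have h := greenL_iff.1 h
        rw [u.rightHill_eq, v.rightHill_eq, AltWord.mk.injEq] at h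
        exact h.1
      · rw [peak, peak, greenR_iff.1 h]
    | refl => rfl
    | symm _ _ _ ih => exact ih.symm
    | trans _ _ _ _ _ ih ih' => exact ih.trans ih'
  · intro h
    -- The intermediate mountain has the left hill of `u` and the right hill of `v`; they fit
    -- together because the peaks agree.
    obtain ⟨w, -, h1, h2, -⟩ := exists_of_hills (h ▸ u.path_ups) v.path_downs u.allUp_ups
      v.allDown_downs
    refine .trans _ w _ (.rel _ _ (Or.inr (greenR_iff.2 ?_))) (.rel _ _ (Or.inl (greenL_iff.2 ?_)))
    · rw [h1, u.leftHill_eq]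
    · rw [h2, v.rightHill_eq]

theorem exists_equivF11_eq_val (g : GPrime) :
    ∃ u : Mountain, equivF11 u = cls (letter g.toAlphabet) ∧ u.peak = g := by
  obtain ⟨u, h, -, -, hp⟩ := exists_of_hills g.path_upPath g.path_downPath g.allUp_upPath
    g.allDown_downPath
  refine ⟨u, ?_, hp⟩
  rw [equivF11_apply, cls_toWord, h, ev_upPath_downPath]
  rfl

/-- On mountains `D` compares peaks, and `[g]` corresponds to a mountain with peak `g`; so the
unique representative is the peak of the mountain of `c`. -/
theorem existsUnique_greenD_letter (c : F11) :
    ∃! g : GPrime, GreenD c (cls (letter g.toAlphabet)) := by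
  obtain ⟨u, rfl⟩ := equivF11.surjective c
  have key : ∀ g : GPrime, GreenD (equivF11 u) (cls (letter g.toAlphabet)) ↔ u.peak = g := by
    intro g
    obtain ⟨v, hv, rfl⟩ := exists_equivF11_eq_val g
    rw [← hv, ← greenD_iff_peak]
    exact greenD_map_iff equivF11
  exact ⟨u.peak, (key _).2 rfl, fun g hg => ((key g).1 hg).symm⟩

end Green

end Mountain

end WeakGen

theorem mainTheorem6 :
    -- `⊙` is well defined: `u ⊙ v` is the only mountain to which `u * v` reduces
    (∀ u v w : WeakGen.Mountain,
      Relation.ReflTransGen WeakGen.AltWord.Uplift (u.word.star v.word) w.word ↔ w = u * v) ∧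
    -- the mountains are a model of `F_1^1`
    (∃ e : WeakGen.Mountain ≃* WeakGen.F11,
      ∀ u : WeakGen.Mountain, e u = WeakGen.cls u.word.toWord) ∧
    -- the quasi-orders
    (∀ u v : WeakGen.Mountain,
      (WeakGen.LeR u v ↔ v.leftHill.letters <+: u.leftHill.letters) ∧
      (WeakGen.LeL u v ↔ v.rightHill.letters <:+ u.rightHill.letters) ∧
      (WeakGen.LeJ u v ↔ v.peak.1 ∈ WeakGen.Letter.ground u.peak.1)) ∧
    -- Green's relations
    (∀ u v : WeakGen.Mountain,
      (WeakGen.GreenR u v ↔ u.leftHill = v.leftHill) ∧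
      (WeakGen.GreenL u v ↔ u.rightHill = v.rightHill) ∧
      (WeakGen.GreenJ u v ↔ u.peak = v.peak) ∧
      (WeakGen.GreenH u v ↔ u = v) ∧
      (WeakGen.GreenD u v ↔ WeakGen.GreenJ u v)) ∧
    -- the classes `[g]` with `g ∈ G'` form a transversal of the `D`-classes of `F_1^1`
    (∀ c : WeakGen.F11, ∃! g : WeakGen.GPrime,
      WeakGen.GreenD c (WeakGen.cls (WeakGen.letter g.toAlphabet))) :=
  ⟨fun _ _ _ => WeakGen.Mountain.reduces_iff_conv.trans WeakGen.Mountain.conv_mul_iff,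
    ⟨WeakGen.Mountain.equivF11, WeakGen.Mountain.equivF11_apply⟩,
    fun _ _ => ⟨WeakGen.Mountain.leR_iff_leftHill, WeakGen.Mountain.leL_iff_rightHill,
      WeakGen.Mountain.leJ_iff_ground⟩,
    fun _ _ => ⟨WeakGen.Mountain.greenR_iff, WeakGen.Mountain.greenL_iff,
      WeakGen.Mountain.greenJ_iff, WeakGen.Mountain.greenH_iff,
      WeakGen.Mountain.greenD_iff_peak.trans WeakGen.Mountain.greenJ_iff.symm⟩,
    WeakGen.Mountain.existsUnique_greenD_letter⟩
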